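/- **Setting.** Let $M$ be a compact connected 3-manifold with non-empty boundary, and let $\mathcal T$ be a topological ideal triangulation of $M$, i.e. a finite set of tetrahedra $\Delta_k$ with their faces glued in pairs, such that $M$ is obtained by truncating the vertices. Let $\widehat M$ be obtained from $M$ by collapsing each boundary component to a point, let $\widetilde M$ be the universal cover, and let $I(\widetilde M)$ be the set of ideal points of $\widetilde M$ (one for each of its boundary components). Let $P\subset B\subset \mathrm{SL}(2,\mathbb C)$ be the groups of upper triangular unipotent and of upper triangular matrices. *Transitive partitions.* A transitive partition of $\mathcal T$ is a partition of the edges of $\mathcal T$ into zero-edges and nonzero edges such that, if two edges of a face are zero-edges, so is the third. Let $\mathcal E(\mathcal T)$ be the set of these. It contains the partition without zero-edges and the totally degenerate partition $0$, all of whose edges are zero-edges. A face or simplex is degenerate if all its edges are zero-edges. *Ptolemy varieties.* $P(\mathcal T)$ is the set of all assignments of nonzero complex numbers $c_{ij,k}$ to the oriented edges $ij$ of the simplices $\Delta_k$ such that $c_{ji,k}=-c_{ij,k}$, $\;c_{03,k}c_{12,k}+c_{01,k}c_{23,k}=c_{02,k}c_{13,k}$, and $c_{ij,k}=c_{i'j',k'}$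 whenever the oriented edges $ij$ of $\Delta_k$ and $i'j'$ of $\Delta_{k'}$ are identified by a face pairing. For a cellular 2-cocycle $\sigma$ on $\widehat M$ with values in $\mathbb Z/2=\{\pm1\}$ and cochains $\eta_k\in C^1(\Delta_k;\mathbb Z/2)$ with $\delta\eta_k=\sigma|_{\Delta_k}$, the variety $P^\sigma(\mathcal T)$ is defined in the same way, with the identification relations $c_{ij,k}=\eta_{ij,k}\,\eta_{i'j',k'}\,c_{i'j',k'}$. If all boundary components $\partial_sM$ ($s=1,\dots,r$) are tori, with bases $\mu_s,\lambda_s$ of $H_1(\partial_sM)$, choose lifts of the triangles of $\partial_sM$ to its universal cover that form a fundamental domain $R_s$ (for instance a fundamental rectangle). Crossing from the triangle of $R_s$ at the vertex $i$ of $\Delta_k$ through the face opposite to the vertex $f$ leads to a translate $R_s+a\mu_s+b\lambda_s$, and one puts $t_{i,f,k}=m_s^a l_s^b$. The enhanced variety $\mathcal EP(\mathcal T)$ is the set of all $(c,m,l)$, where $m_s,l_s\in\mathbb C^*$ and the $c_{ij,k}$ are nonzero and satisfy the same relations, except that the identification relation at the face of $\Delta_k$ opposite to $f$ is $c_{i'j',k'}=t_{i,f,k}\,t_{j,f,k}\,c_{ij,k}$.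 *Affine space of virtual edges.* Let $V(M)=(I(\widetilde M)\times I(\widetilde M))/\pi_1(M)$, and let $A(V(M))$ be the affine space with one coordinate for each element of $V(M)$. Each oriented edge of a triangulation is an element of $V(M)$. For $b\neq0$ let $x(a)=\begin{pmatrix}1&a\\0&1\end{pmatrix}$, $q(b)=\begin{pmatrix}0&-b^{-1}\\b&0\end{pmatrix}$, $d(b)=\begin{pmatrix}b&0\\0&b^{-1}\end{pmatrix}$. If each face has at most one zero-edge, Ptolemy coordinates $c$ determine the following labels of those edges of the truncated simplices that are not at zero-edges: $q(c_{ij})$ for the long edge from $i$ to $j$, and $x(c_{jl}/(c_{ji}c_{il}))$ for the short edge at the vertex $i$ from the long edge $ij$ to the long edge $il$; in the enhanced case, the edge leading through the face opposite to $f$ at the vertex $i$ is labeled $d(t_{i,f,k})$. The coordinate of a virtual edge $e$ is the lower left entry of the product $B_e$ of the labels along a path that joins the two ends of $e$ and avoids the zero-edges. This is the canonical embedding in $A(V(M))$; it extends the coordinates of the edges of $\mathcal T$. (For $P^\sigma$ and $\mathcal EP$, the coordinate of a virtual edge is defined relative to chosen representatives, the choices being related by the signs, resp. the monomials in $m_s,l_s$,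 that occur in the identification relations; in the enhanced case the affine space is $A(V(M))\times\mathbb C^{2r}$.) *The invariant varieties.* Let $E\in\mathcal E(\mathcal T)\setminus\{0\}$. If $E$ has no degenerate faces, $P(\mathcal T,E)\subset A(V(M))$ is the image of the set of all $c$ that satisfy the relations above, with $c_{ij,k}=0$ exactly on the zero-edges, and for each zero-edge the edge relation $\sum_k \frac{c_{23,k}}{c_{12,k}c_{13,k}}=0$, where the sum is over the simplices around the edge, coherently ordered such that the edge is their $01$-edge (in the enhanced case the $k$-th summand is multiplied by the square of the product of the monomials picked up at the vertex $1$ on the way to the $k$-th simplex). For $E$ without zero-edges this is the canonical image of $P(\mathcal T)$ itself. If $E$ has degenerate faces but no degenerate simplices, $P(\mathcal T,E)=\bigcup P(\mathcal T',E')$, where $\mathcal T'$ is obtained by 2-3 moves at all degenerate faces and $E'$ runs through the transitive partitions of $\mathcal T'$ that agree with $E$ on $\mathcal T$. If some but not all simplices are degenerate, $P(\mathcal T,E)=P(\mathcal T',E')$, where $\mathcal T'$ is obtained by successive 2-3 moves at faces between a degenerate and a non-degenerate simplex until there are no degenerate simplices, and $E'$ is the transitive partition of $\mathcal T'$ that agrees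 with $E$ on $\mathcal T$. Put $\overline P(\mathcal T)=\bigcup_{E\in\mathcal E(\mathcal T)\setminus\{0\}}P(\mathcal T,E)\subset A(V(M))$, and define $\overline P^\sigma(\mathcal T)$ and $\mathcal E\overline P(\mathcal T)$ similarly. *Representations.* A representation $\pi_1(M)\to\mathrm{SL}(2,\mathbb C)$ is boundary-unipotent (boundary-Borel) if it takes each peripheral subgroup into a conjugate of $P$ (of $B$); for $\mathrm{PSL}(2,\mathbb C)$, boundary-unipotent refers to the image of $P$. A boundary-unipotent representation in $\mathrm{PSL}(2,\mathbb C)$ has obstruction class $[\sigma]\in H^2(\widehat M;\mathbb Z/2)$ if it is given by a cocycle on the truncated triangulation, labeling short edges by $P$, whose labels have lifts to $\mathrm{SL}(2,\mathbb C)$ (in $P$ for short edges, compatible with the face pairings) with product $\sigma(F)$ around each hexagonal face $F$. A representation is irreducible if it leaves no line in $\mathbb C^2$ invariant. A point $c$ of $P(\mathcal T)$, $P^\sigma(\mathcal T)$ or $\mathcal EP(\mathcal T)$ determines, by the labels above, a representation up to conjugation (in $\mathrm{PSL}(2,\mathbb C)$ for $P^\sigma(\mathcal T)$). **Theorem.**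 Suppose that $\mathcal E(\mathcal T)$ has exactly two elements. Then $$\overline P(\mathcal T)=P(\mathcal T),\qquad \overline P^\sigma(\mathcal T)=P^\sigma(\mathcal T),\qquad \mathcal E\overline P(\mathcal T)=\mathcal EP(\mathcal T),$$ where $\sigma$ is any cocycle as above, and in the third equality all boundary components are tori with chosen bases. That is, each invariant variety equals the canonical image of the standard one in the affine space of virtual edges, and restriction to the coordinates of the edges of $\mathcal T$ is a bijection from the invariant variety onto the standard one. Moreover, the standard Ptolemy varieties detect all irreducible representations of the relevant type: every irreducible boundary-unipotent representation $\pi_1(M)\to\mathrm{SL}(2,\mathbb C)$, every irreducible boundary-unipotent representation $\pi_1(M)\to\mathrm{PSL}(2,\mathbb C)$ with obstruction class $[\sigma]$, and (for torus boundary) every irreducible boundary-Borel representation $\pi_1(M)\to\mathrm{SL}(2,\mathbb C)$ is, up to conjugation, determined by a point of $P(\mathcal T)$, of $P^\sigma(\mathcal T)$, and of $\mathcal EP(\mathcal T)$, respectively. -/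

import Mathlib

universe u

namespace Ptolemy

open Equiv

/-! ## Triangulations -/

/-- Face-pairing data of a (generalized) triangulation by tetrahedra with vertices `0,1,2,3`.
The face of `k` opposite to its vertex `f` is glued to the face of `adj k f` opposite to
`glue k f f`; a vertex `i ≠ f` of `k` is glued to the vertex `glue k f i` of `adj k f`.
All faces are paired, and no face is glued to itself. Removing the vertices (or truncating the
tetrahedra) gives the manifold `M`, of which this is a topological ideal triangulation. -/
structure Tri (S : Type u) where
  adj : S → Fin 4 → S
  glue : S → Fin 4 → Perm (Fin 4)
  adj_adj : ∀ k f, adj (adj k f) (glue k f f) = k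
  glue_glue : ∀ k f, glue (adj k f) (glue k f f) = (glue k f)⁻¹
  no_self : ∀ k f, ¬ (adj k f = k ∧ glue k f f = f)

namespace Tri

variable {S : Type u} (T : Tri S)

/-- The simplex reached from `k` by successively crossing the faces in the list `w`. Such lists
are paths in the dual graph; they also describe paths in the universal cover of `M`. -/
def endpt (k : S) (w : List (Fin 4)) : S := w.foldl T.adj k

/-- `M` is connected. -/
def Connected : Prop := ∀ k k', ∃ w, T.endpt k w = k'

/-- Identification of the oriented edge `i → j` of `k` with an oriented edge of a neighbour. -/
def EdgeStep (e e' : S × Fin 4 × Fin 4) : Prop :=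
  ∃ f, f ≠ e.2.1 ∧ f ≠ e.2.2 ∧
    e' = (T.adj e.1 f, T.glue e.1 f e.2.1, T.glue e.1 f e.2.2)

/-- No edge is identified with itself in reverse. This is exactly what makes the complex of
truncated tetrahedra a 3-manifold with boundary. -/
def IsManifold : Prop :=
  ∀ k i j, i ≠ j → ¬ Relation.EqvGen T.EdgeStep (k, i, j) (k, j, i)

/-- Rotation about an edge. A flag `(k, s)` is a simplex whose vertices are ordered as
`s 0, s 1, s 2, s 3`. We cross the face `{s 0, s 1, s 3}` into the next simplex around the edge
`s 0 s 1`, ordered so that this common face is `{0, 1, 2}` there. -/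
def rot (x : S × Perm (Fin 4)) : S × Perm (Fin 4) :=
  (T.adj x.1 (x.2 2), T.glue x.1 (x.2 2) * x.2 * swap 2 3)

/-- The number of simplices around the edge `01` of the flag `x`. -/
noncomputable def edgeDeg (x : S × Perm (Fin 4)) : ℕ := Function.minimalPeriod T.rot x

/-- The path in the dual graph that goes once around the edge `01` of the flag `x`. -/
noncomputable def edgeLoop (x : S × Perm (Fin 4)) : List (Fin 4) :=
  (List.range (T.edgeDeg x)).map fun n => (T.rot^[n] x).2 2

/-! ## The fundamental group

`M` deformation retracts to the dual 2-complex: a vertex for each simplex, an edge for each pair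
of glued faces, a 2-cell for each edge of the triangulation. -/

/-- Homotopy, relative to end points, of paths in the dual 2-complex starting at `k`. -/
inductive Homotopic (k : S) : List (Fin 4) → List (Fin 4) → Prop
  | refl (w) : Homotopic k w w
  | symm {w w'} : Homotopic k w w' → Homotopic k w' w
  | trans {w w' w''} : Homotopic k w w' → Homotopic k w' w'' → Homotopic k w w''
  | back (p q : List (Fin 4)) (f : Fin 4) :
      Homotopic k (p ++ [f, T.glue (T.endpt k p) f f] ++ q) (p ++ q)
  | loop (p q : List (Fin 4)) (x : S × Perm (Fin 4)) (hx : x.1 = T.endpt k p) :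
      Homotopic k (p ++ T.edgeLoop x ++ q) (p ++ q)

variable {T}

theorem endpt_append (k : S) (p q : List (Fin 4)) :
    T.endpt k (p ++ q) = T.endpt (T.endpt k p) q := by
  simp [endpt]

theorem Homotopic.append_right {k : S} {u v : List (Fin 4)} (h : T.Homotopic k u v)
    (r : List (Fin 4)) : T.Homotopic k (u ++ r) (v ++ r) := by
  induction h with
  | refl w => exact .refl _
  | symm _ ih => exact ih.symm
  | trans _ _ ih ih' => exact ih.trans ih'
  | back p q f => simpa using Homotopic.back (T := T) (k := k) p (q ++ r) f
  | loop p q x hx => simpa using Homotopic.loop (T := T) (k := k) p (q ++ r) x hx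

theorem Homotopic.append_left {k : S} (r : List (Fin 4)) {u v : List (Fin 4)}
    (h : T.Homotopic (T.endpt k r) u v) : T.Homotopic k (r ++ u) (r ++ v) := by
  induction h with
  | refl w => exact .refl _
  | symm _ ih => exact ih.symm
  | trans _ _ ih ih' => exact ih.trans ih'
  | back p q f =>
    have := Homotopic.back (T := T) (k := k) (r ++ p) q f
    rw [endpt_append] at this
    simpa using this
  | loop p q x hx =>
    have := Homotopic.loop (T := T) (k := k) (r ++ p) q x (by rw [endpt_append]; exact hx)
    simpa using this

variable (T) in
/-- The reverse of a path starting at `k`. -/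
def rev : S → List (Fin 4) → List (Fin 4)
  | _, [] => []
  | k, f :: w => rev (T.adj k f) w ++ [T.glue k f f]

theorem endpt_rev (k : S) (w : List (Fin 4)) : T.endpt (T.endpt k w) (T.rev k w) = k := by
  induction w generalizing k with
  | nil => rfl
  | cons f w ih =>
    have h1 : T.endpt k (f :: w) = T.endpt (T.adj k f) w := rfl
    rw [h1, rev, endpt_append, ih]
    exact T.adj_adj k f

theorem append_rev (k : S) (w : List (Fin 4)) : T.Homotopic k (w ++ T.rev k w) [] := by
  induction w generalizing k with
  | nil => exact .refl _
  | cons f w ih =>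
    have h1 : T.Homotopic (T.endpt k [f]) (w ++ T.rev (T.adj k f) w) [] := ih _
    have h2 := (h1.append_left [f]).append_right [T.glue k f f]
    have h3 := Homotopic.back (T := T) (k := k) [] [] f
    refine Homotopic.trans (w' := [f] ++ [] ++ [T.glue k f f]) ?_ h3
    simpa [rev] using h2

theorem rev_append (k : S) (w : List (Fin 4)) :
    T.Homotopic (T.endpt k w) (T.rev k w ++ w) [] := by
  induction w generalizing k with
  | nil => exact .refl _
  | cons f w ih =>
    refine Homotopic.trans ?_ (ih (T.adj k f))
    have h := Homotopic.back (T := T) (k := T.endpt (T.adj k f) w) (T.rev (T.adj k f) w) w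
      (T.glue k f f)
    rw [endpt_rev, T.glue_glue] at h
    have h1 : T.endpt k (f :: w) = T.endpt (T.adj k f) w := rfl
    rw [h1]
    simpa [rev] using h

theorem endpt_rev_of_closed {k : S} {w : List (Fin 4)} (h : T.endpt k w = k) :
    T.endpt k (T.rev k w) = k := by
  have := endpt_rev (T := T) k w
  rwa [h] at this

variable (T)

/-- Closed paths at `k`. -/
def Loop (k : S) : Type := {w : List (Fin 4) // T.endpt k w = k}

instance loopSetoid (k : S) : Setoid (T.Loop k) where
  r a b := T.Homotopic k a.1 b.1
  iseqv := ⟨fun _ => .refl _, fun h => h.symm, fun h h' => h.trans h'⟩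

/-- The fundamental group `π₁(M)`, based in the simplex `k`. -/
def Pi1 (k : S) : Type := Quotient (T.loopSetoid k)

variable {T}

/-- The element of `π₁(M)` represented by a closed path. -/
def Loop.cls {k : S} (a : T.Loop k) : T.Pi1 k := Quotient.mk _ a

instance (k : S) : Group (T.Pi1 k) where
  mul := Quotient.map₂
    (fun a b => ⟨a.1 ++ b.1, by rw [endpt_append, a.2, b.2]⟩)
    (by
      intro a a' ha b b' hb
      refine Homotopic.trans (Homotopic.append_right ha b.1) (Homotopic.append_left a'.1 ?_)
      rw [a'.2]; exact hb)
  one := Quotient.mk _ ⟨[], rfl⟩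
  inv := Quotient.map
    (fun a => ⟨T.rev k a.1, endpt_rev_of_closed a.2⟩)
    (by
      intro a b hab
      change T.Homotopic k (T.rev k a.1) (T.rev k b.1)
      have h1 : T.Homotopic k (T.rev k a.1 ++ (b.1 ++ T.rev k b.1)) (T.rev k a.1 ++ []) :=
        Homotopic.append_left _ (by
          rw [endpt_rev_of_closed a.2]; exact append_rev k b.1)
      have h2 : T.Homotopic k (T.rev k a.1 ++ a.1) (T.rev k a.1 ++ b.1) :=
        Homotopic.append_left _ (by
          rw [endpt_rev_of_closed a.2]; exact hab)
      have h3 : T.Homotopic k (T.rev k a.1 ++ a.1) [] := by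
        have := rev_append (T := T) k a.1
        rwa [a.2] at this
      have h4 := (h2.symm.trans h3).append_right (T.rev k b.1)
      simp only [List.append_nil, List.nil_append, List.append_assoc] at h1 h4
      exact h1.symm.trans h4)
  mul_assoc := by
    rintro ⟨a⟩ ⟨b⟩ ⟨c⟩
    exact congrArg (Quotient.mk _) (Subtype.ext (List.append_assoc _ _ _))
  one_mul := by
    rintro ⟨a⟩
    exact congrArg (Quotient.mk _) (Subtype.ext (List.nil_append _))
  mul_one := by
    rintro ⟨a⟩
    exact congrArg (Quotient.mk _) (Subtype.ext (List.append_nil _))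
  inv_mul_cancel := by
    rintro ⟨a⟩
    refine Quotient.sound ?_
    change T.Homotopic k (T.rev k a.1 ++ a.1) []
    have := rev_append (T := T) k a.1
    rwa [a.2] at this

variable (T)

/-! ## The boundary of `M`

The boundary triangle near the vertex `i` of `k` is denoted by `(k, i)`. -/

/-- Paths in the dual graph of `∂M`, starting at a boundary triangle. -/
def IsLinkPath : S × Fin 4 → List (Fin 4) → Prop
  | _, [] => True
  | y, f :: w => f ≠ y.2 ∧ IsLinkPath (T.adj y.1 f, T.glue y.1 f y.2) w

/-- The final boundary triangle of a path in the boundary. -/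
def linkEnd (y : S × Fin 4) (w : List (Fin 4)) : S × Fin 4 :=
  w.foldl (fun z f => (T.adj z.1 f, T.glue z.1 f z.2)) y

/-- Homotopy, inside `∂M`, of paths starting at the boundary triangle `y`. -/
inductive LinkHomotopic (y : S × Fin 4) : List (Fin 4) → List (Fin 4) → Prop
  | refl (w) : LinkHomotopic y w w
  | symm {w w'} : LinkHomotopic y w w' → LinkHomotopic y w' w
  | trans {w w' w''} : LinkHomotopic y w w' → LinkHomotopic y w' w'' → LinkHomotopic y w w''
  | back (p q : List (Fin 4)) (f : Fin 4) (hf : f ≠ (T.linkEnd y p).2) :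
      LinkHomotopic y (p ++ [f, T.glue (T.linkEnd y p).1 f f] ++ q) (p ++ q)
  | loop (p q : List (Fin 4)) (x : S × Perm (Fin 4)) (hx : (x.1, x.2 0) = T.linkEnd y p) :
      LinkHomotopic y (p ++ T.edgeLoop x ++ q) (p ++ q)

/-- The set of boundary components of `M`, i.e. of vertices of the triangulation. -/
def Cusp : Type u :=
  Quot fun y z : S × Fin 4 => ∃ f, f ≠ y.2 ∧ z = (T.adj y.1 f, T.glue y.1 f y.2)

/-- `a` represents an element of the peripheral subgroup of `π₁(M)` at the ideal point reached
from the base simplex `k` by the path `w` and the vertex `i`. -/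
def IsPeripheral (k : S) (w : List (Fin 4)) (i : Fin 4) (a : T.Loop k) : Prop :=
  ∃ p, T.IsLinkPath (T.endpt k w, i) p ∧ T.linkEnd (T.endpt k w, i) p = (T.endpt k w, i) ∧
    T.Homotopic k (a.1 ++ w) (w ++ p)

/-- The representation `ρ` takes each peripheral subgroup to a conjugate of `H`. -/
def BoundaryIn {G : Type*} [Group G] (H : Set G) {k : S} (ρ : T.Pi1 k →* G) : Prop :=
  ∀ w i, ∃ g : G, ∀ a, T.IsPeripheral k w i a → g⁻¹ * ρ a.cls * g ∈ H

/-! ## Transitive partitions -/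

/-- A transitive partition, given by the set `Z` of all `(k, i, j)` such that the edge `ij` of
`k` is a zero-edge. -/
structure IsTransitivePartition (Z : Set (S × Fin 4 × Fin 4)) : Prop where
  ne : ∀ k i j, (k, i, j) ∈ Z → i ≠ j
  symm : ∀ k i j, (k, i, j) ∈ Z → (k, j, i) ∈ Z
  ident : ∀ k f i j, f ≠ i → f ≠ j →
    ((T.adj k f, T.glue k f i, T.glue k f j) ∈ Z ↔ (k, i, j) ∈ Z)
  trans : ∀ k i j l, i ≠ l → (k, i, j) ∈ Z → (k, j, l) ∈ Z → (k, i, l) ∈ Z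

/-- The set `ℰ(𝒯)` of transitive partitions. -/
def transitivePartitions : Set (Set (S × Fin 4 × Fin 4)) := {Z | T.IsTransitivePartition Z}

/-- The totally degenerate partition `0`. -/
def totallyDegenerate (S : Type u) : Set (S × Fin 4 × Fin 4) := {e | e.2.1 ≠ e.2.2}

/-- The face of `k` opposite to `f` is degenerate. -/
def IsDegFace (Z : Set (S × Fin 4 × Fin 4)) (k : S) (f : Fin 4) : Prop :=
  ∀ i j, i ≠ j → i ≠ f → j ≠ f → (k, i, j) ∈ Z

/-- The simplex `k` is degenerate. -/
def IsDegSimplex (Z : Set (S × Fin 4 × Fin 4)) (k : S) : Prop :=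
  ∀ i j, i ≠ j → (k, i, j) ∈ Z

/-! ## Ptolemy assignments -/

/-- The edge orientation relations, the identification relations with factors `θ k f i j` (for
the edge `ij` of the face of `k` opposite to `f`) and the Ptolemy relations. -/
structure IsPtolemy (θ : S → Fin 4 → Fin 4 → Fin 4 → ℂ) (c : S → Fin 4 → Fin 4 → ℂ) : Prop where
  orient : ∀ k i j, c k j i = - c k i j
  ident : ∀ k f i j, f ≠ i → f ≠ j →
    c (T.adj k f) (T.glue k f i) (T.glue k f j) = θ k f i j * c k i j
  ptolemy : ∀ k, c k 0 3 * c k 1 2 + c k 0 1 * c k 2 3 = c k 0 2 * c k 1 3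

/-- The (non-degenerate) Ptolemy variety with identification factors `θ`. -/
def ptolemyWith (θ : S → Fin 4 → Fin 4 → Fin 4 → ℂ) : Set (S → Fin 4 → Fin 4 → ℂ) :=
  {c | T.IsPtolemy θ c ∧ ∀ k i j, i ≠ j → c k i j ≠ 0}

/-- The standard Ptolemy variety `P(𝒯)`. -/
def ptolemy : Set (S → Fin 4 → Fin 4 → ℂ) := T.ptolemyWith fun _ _ _ _ => 1

/-- Cellular 2-cocycles on `M̂` with values in `ℤ/2 = {±1}`; `σ k f` is the value on the face of
`k` opposite to `f`. -/
structure IsCocycle (σ : S → Fin 4 → ℤˣ) : Prop where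
  ident : ∀ k f, σ (T.adj k f) (T.glue k f f) = σ k f
  closed : ∀ k, ∏ f, σ k f = 1

/-- `η k` is a 1-cochain on the simplex `k` with coboundary the restriction of `σ` to `k`. -/
structure IsPrimitive (σ : S → Fin 4 → ℤˣ) (η : S → Fin 4 → Fin 4 → ℤˣ) : Prop where
  symm : ∀ k i j, η k j i = η k i j
  cobdry : ∀ k f i j l, [f, i, j, l].Nodup → η k i j * η k j l * η k l i = σ k f

/-- The variety `P^σ(𝒯)`, where `η` is the chosen family of primitives of `σ`. -/
def sigmaPtolemy (η : S → Fin 4 → Fin 4 → ℤˣ) : Set (S → Fin 4 → Fin 4 → ℂ) :=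
  T.ptolemyWith fun k f i j =>
    ((η k i j * η (T.adj k f) (T.glue k f i) (T.glue k f j) : ℤˣ) : ℤ)

/-- The sum of `wt k i f` over the steps of a path in the boundary, where a step crosses from the
boundary triangle `(k, i)` through the face of `k` opposite to `f`. -/
def linkSum (wt : S → Fin 4 → Fin 4 → ℤ × ℤ) : S × Fin 4 → List (Fin 4) → ℤ × ℤ
  | _, [] => 0
  | y, f :: w => wt y.1 y.2 f + linkSum wt (T.adj y.1 f, T.glue y.1 f y.2) w

/-- Each boundary component `∂_s M` is a torus with a basis `μ_s, λ_s` of its first homology, and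
the boundary triangles have been lifted to the universal cover of `∂M` so that they form a
fundamental domain `R_s` of each `∂_s M` (a fundamental rectangle, for instance):
`wt k i f = (a, b)` says that crossing from the triangle `(k, i)` of `R_s` through the face
opposite to `f` leads to the translate of `R_s` by `a μ_s + b λ_s`.

The first two fields say that `wt` is a 1-cocycle on `∂M`, hence induces a homomorphism
`π₁(∂_s M) → ℤ²`; the other three say that it is an isomorphism. Thus `∂_s M` is a torus, and
`μ_s, λ_s` are the classes taken to `(1, 0)` and `(0, 1)`. -/
structure IsFraming (wt : S → Fin 4 → Fin 4 → ℤ × ℤ) : Prop where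
  antisymm : ∀ k i f, f ≠ i → wt (T.adj k f) (T.glue k f i) (T.glue k f f) = - wt k i f
  closed : ∀ x : S × Perm (Fin 4), ∑ n ∈ Finset.range (T.edgeDeg x),
    wt (T.rot^[n] x).1 ((T.rot^[n] x).2 0) ((T.rot^[n] x).2 2) = 0
  meridian : ∀ y, ∃ p, T.IsLinkPath y p ∧ T.linkEnd y p = y ∧ T.linkSum wt y p = (1, 0)
  longitude : ∀ y, ∃ p, T.IsLinkPath y p ∧ T.linkEnd y p = y ∧ T.linkSum wt y p = (0, 1)
  injective : ∀ y p, T.IsLinkPath y p → T.linkEnd y p = y → T.linkSum wt y p = 0 →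
    T.LinkHomotopic y p []

/-- The monomial `m_s ^ a * l_s ^ b`, where `s` is the boundary component of `(k, i)` and
`(a, b) = wt k i f`. -/
noncomputable def monomial (wt : S → Fin 4 → Fin 4 → ℤ × ℤ) (m l : T.Cusp → ℂ)
    (k : S) (i f : Fin 4) : ℂ :=
  m (Quot.mk _ (k, i)) ^ (wt k i f).1 * l (Quot.mk _ (k, i)) ^ (wt k i f).2

/-- The enhanced Ptolemy variety `ℰP(𝒯)`. -/
def enhancedPtolemy (wt : S → Fin 4 → Fin 4 → ℤ × ℤ) :
    Set ((S → Fin 4 → Fin 4 → ℂ) × (T.Cusp → ℂ) × (T.Cusp → ℂ)) :=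
  {z | (∀ s, z.2.1 s ≠ 0) ∧ (∀ s, z.2.2 s ≠ 0) ∧ z.1 ∈ T.ptolemyWith fun k f i j =>
    T.monomial wt z.2.1 z.2.2 k i f * T.monomial wt z.2.1 z.2.2 k j f}

end Tri

/-! ## Ideal points, virtual edges, and their affine space -/

/-- `(w, i)` describes an ideal point of the universal cover of `M`, as seen from a lift of a
simplex: follow the path `w` and take the vertex `i` of the final simplex. -/
abbrev IdealPt := List (Fin 4) × Fin 4

variable {S : Type u}

/-- The coordinate functions that form the affine space of `V(M)`.

A triple `(k, x, y)` represents the virtual edge of `M` from `x` to `y`, where `x, y` are ideal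
points of the universal cover seen from a lift of the simplex `k`. Two triples represent the
same virtual edge (the same pair of ideal points up to `π₁(M)`) if and only if they are related
by changing `k` (`anchor`), by moving the final simplex of an end point through a face that
contains the ideal point (`slide`), and by homotopies of the two paths (`back`, `loop`).
For `t = 1` the conditions below hence say that `X` is a function on the set `V(M)`.

In general `t k i f` is the factor by which the coordinates change when the end point `i` is
moved from `k` through the face opposite to `f`. The value of `X` on one representative of a
virtual edge then determines the value on all others, so that a choice of representatives
identifies such `X` with points of the affine space of `V(M)`. -/
structure IsCoordinateFn (T : Tri S) (t : S → Fin 4 → Fin 4 → ℂ)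
    (X : S → IdealPt → IdealPt → ℂ) : Prop where
  anchor : ∀ k f p q i j, X k (f :: p, i) (f :: q, j) = X (T.adj k f) (p, i) (q, j)
  slide_left : ∀ k p i f y, i ≠ f →
    X k (p ++ [f], T.glue (T.endpt k p) f i) y = t (T.endpt k p) i f * X k (p, i) y
  slide_right : ∀ k p i f y, i ≠ f →
    X k y (p ++ [f], T.glue (T.endpt k p) f i) = t (T.endpt k p) i f * X k y (p, i)
  back_left : ∀ k p f q i y,
    X k (p ++ [f, T.glue (T.endpt k p) f f] ++ q, i) y = X k (p ++ q, i) y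
  back_right : ∀ k p f q i y,
    X k y (p ++ [f, T.glue (T.endpt k p) f f] ++ q, i) = X k y (p ++ q, i)
  loop_left : ∀ k p (x : S × Perm (Fin 4)) q i y, x.1 = T.endpt k p →
    X k (p ++ T.edgeLoop x ++ q, i) y = (∏ n ∈ Finset.range (T.edgeDeg x),
      t (T.rot^[n] x).1 ((T.rot^[n] x).2 0) ((T.rot^[n] x).2 2)) * X k (p ++ q, i) y
  loop_right : ∀ k p (x : S × Perm (Fin 4)) q i y, x.1 = T.endpt k p →
    X k y (p ++ T.edgeLoop x ++ q, i) = (∏ n ∈ Finset.range (T.edgeDeg x),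
      t (T.rot^[n] x).1 ((T.rot^[n] x).2 0) ((T.rot^[n] x).2 2)) * X k y (p ++ q, i)

/-- The coordinates of the edges of the triangulation. -/
def edgeCoords (X : S → IdealPt → IdealPt → ℂ) (k : S) (i j : Fin 4) : ℂ := X k ([], i) ([], j)

/-! ## Further triangulations of the same manifold -/

/-- A triangulation `tri` of the manifold triangulated by a fixed triangulation with set of
simplices `S`. To relate the two universal covers, each simplex `n` of `tri` is lifted and seen
from a lift of a simplex `anchor n`; `pos n i` is the position of its vertex `i`, and `lab n f`
is the path from `anchor n` to `anchor (tri.adj n f)` that corresponds to crossing the face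
opposite to `f`. Finally `wt n i f` is the factor attached to moving the vertex `i` through that
face; a Ptolemy assignment on `tri` has the identification factors `wt n i f * wt n j f`. -/
structure Marked (S : Type u) where
  Simp : Type u
  tri : Tri Simp
  wt : Simp → Fin 4 → Fin 4 → ℂ
  anchor : Simp → S
  pos : Simp → Fin 4 → IdealPt
  lab : Simp → Fin 4 → List (Fin 4)

/-- The triangulation itself. -/
def Tri.marked (T : Tri S) (t : S → Fin 4 → Fin 4 → ℂ) : Marked S where
  Simp := S
  tri := T
  wt := t
  anchor := id
  pos _ i := ([], i)
  lab _ f := [f]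

/-! ## Cocycles on the truncated complex

`(n, i, j)` denotes the vertex of the truncated simplex `n` near the ideal vertex `i` on the long
edge `ij`. -/

/-- A labeling of the oriented edges: `long n i j` is the label of the long edge from `(n, i, j)`
to `(n, j, i)`; `short n i j l` that of the short edge from `(n, i, j)` to `(n, i, l)`, and
`cross n i f` that of the face pairing edges that lead from `(n, i, j)`, for `j ≠ f`, through the
face opposite to `f` to the corresponding vertex of the adjacent truncated simplex. -/
structure Labeling (S : Type u) where
  long : S → Fin 4 → Fin 4 → Matrix (Fin 2) (Fin 2) ℂ
  short : S → Fin 4 → Fin 4 → Fin 4 → Matrix (Fin 2) (Fin 2) ℂ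
  cross : S → Fin 4 → Fin 4 → Matrix (Fin 2) (Fin 2) ℂ

/-- `x(a)` -/
def matX (a : ℂ) : Matrix (Fin 2) (Fin 2) ℂ := !![1, a; 0, 1]
/-- `q(b)` -/
noncomputable def matQ (b : ℂ) : Matrix (Fin 2) (Fin 2) ℂ := !![0, -b⁻¹; b, 0]
/-- `d(b)` -/
noncomputable def matD (b : ℂ) : Matrix (Fin 2) (Fin 2) ℂ := !![b, 0; 0, b⁻¹]

/-- The (fattened) natural cocycle of Ptolemy coordinates `c` with face pairing factors `t`: the
label of the long edge `ij` is `q(c_ij)`, the label of the short edge near `i` that is parallel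
to `jl` is `x(c_jl / (c_ji c_il))`. Only edges at vertices `(n, i, j)` with `c_ij ≠ 0` are used. -/
noncomputable def naturalCocycle (t : S → Fin 4 → Fin 4 → ℂ) (c : S → Fin 4 → Fin 4 → ℂ) :
    Labeling S where
  long n i j := matQ (c n i j)
  short n i j l := matX (c n j l / (c n j i * c n i l))
  cross n i f := matD (t n i f)

/-- `Trace M L ok v v' w B`: there is an edge path from `v` to `v'` through vertices satisfying
`ok` (on nonzero edges), such that `B` is the product of the labels along the path and `w` is the
path that it follows in the underlying manifold. -/
inductive Trace (M : Marked S) (L : Labeling M.Simp) (ok : M.Simp → Fin 4 → Fin 4 → Prop)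
    (v : M.Simp × Fin 4 × Fin 4) :
    M.Simp × Fin 4 × Fin 4 → List (Fin 4) → Matrix (Fin 2) (Fin 2) ℂ → Prop
  | start : v.2.1 ≠ v.2.2 → ok v.1 v.2.1 v.2.2 → Trace M L ok v v [] 1
  | long {n i j w B} : Trace M L ok v (n, i, j) w B → ok n j i →
      Trace M L ok v (n, j, i) w (B * L.long n i j)
  | short {n i j w B} (l : Fin 4) : Trace M L ok v (n, i, j) w B → l ≠ i → ok n i l →
      Trace M L ok v (n, i, l) w (B * L.short n i j l)
  | cross {n i j w B} (f : Fin 4) : Trace M L ok v (n, i, j) w B → f ≠ i → f ≠ j →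
      ok (M.tri.adj n f) (M.tri.glue n f i) (M.tri.glue n f j) →
      Trace M L ok v (M.tri.adj n f, M.tri.glue n f i, M.tri.glue n f j) (w ++ M.lab n f)
        (B * L.cross n i f)

/-- `X` consists of the virtual edge coordinates determined by the Ptolemy assignment `c` on `M`:
the coordinate of a virtual edge is `det (e₁, B e₁)`, the lower left entry of `B`, where `B` is
the product of the labels along an edge path, avoiding the zero-edges, that joins its ends. -/
def HasCoordinates (M : Marked S) (c : M.Simp → Fin 4 → Fin 4 → ℂ)
    (X : S → IdealPt → IdealPt → ℂ) : Prop :=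
  ∀ n i j n' i' j' w B,
    Trace M (naturalCocycle M.wt c) (fun n i j => c n i j ≠ 0) (n, i, j) (n', i', j') w B →
      X (M.anchor n) (M.pos n i) (w ++ (M.pos n' i').1, (M.pos n' i').2) = B 1 0

/-! ## The Ptolemy variety of a partition -/

namespace Marked

variable (M : Marked S)

/-- Ptolemy assignments of type `Z` that satisfy the edge relations around the zero-edges, where
`Z` is a transitive partition without degenerate faces. For a flag `x` we denote by `0,1,2,3` its
ordered vertices; the sum is over the simplices around the edge `01`. -/
structure IsMildPoint (Z : Set (M.Simp × Fin 4 × Fin 4)) (c : M.Simp → Fin 4 → Fin 4 → ℂ) :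
    Prop where
  isPtolemy : M.tri.IsPtolemy (fun n f i j => M.wt n i f * M.wt n j f) c
  type : ∀ n i j, i ≠ j → (c n i j = 0 ↔ (n, i, j) ∈ Z)
  edge : ∀ x : M.Simp × Perm (Fin 4), (x.1, x.2 0, x.2 1) ∈ Z →
    let y := fun r => M.tri.rot^[r] x
    ∑ r ∈ Finset.range (M.tri.edgeDeg x),
      c (y r).1 ((y r).2 2) ((y r).2 3) /
        (c (y r).1 ((y r).2 1) ((y r).2 2) * c (y r).1 ((y r).2 1) ((y r).2 3)) *
        ∏ s ∈ Finset.range r, M.wt (y s).1 ((y s).2 1) ((y s).2 2) ^ 2 = 0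

end Marked

/-! ### 2-3 moves -/

section Move

variable {N : Type u} (T : Tri N) (a : N) (f : Fin 4)

/-- The simplices after the 2-3 move at the face of `a` opposite to `f`. The two simplices at
this face are replaced by three simplices around a new edge, indexed by the vertices `v ≠ f` of
`a`. The simplex `v` has the same vertices as `a`, except that its vertex `v` is the vertex of
`adj a f` opposite to the common face; the new edge is `fv`. -/
abbrev NewSimp : Type u := {k : N // k ≠ a ∧ k ≠ T.adj a f} ⊕ {v : Fin 4 // v ≠ f}

/-- `v` as an index different from `f` (with an irrelevant value if `v = f`). -/
def toIndex (v : Fin 4) : {v : Fin 4 // v ≠ f} :=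
  if h : v ≠ f then ⟨v, h⟩ else ⟨f + 1, by fin_cases f <;> decide⟩

/-- The faces shared by two of the three new simplices. -/
def IsInner : NewSimp T a f → Fin 4 → Prop
  | .inl _, _ => False
  | .inr v, h => h ≠ f ∧ h ≠ v

/-- The old face that becomes the (not inner) face `h` of a new simplex, with the bijection from
the old to the new names of the vertices. -/
def oldFace : NewSimp T a f → Fin 4 → N × Fin 4 × Perm (Fin 4)
  | .inl k, h => (k, h, 1)
  | .inr v, h =>
      if h = f then (T.adj a f, T.glue a f v, swap f v * (T.glue a f)⁻¹) else (a, h, 1)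

open Classical in
/-- The new simplex that has the old face `(k, h)` as a face, with the bijection from the old to
the new names of the vertices. Not used for the face at which the move is performed. -/
noncomputable def newSimp (k : N) (h : Fin 4) : NewSimp T a f × Perm (Fin 4) :=
  if ha : k = a then (.inr (toIndex f h), 1)
  else if hb : k = T.adj a f then
    (.inr (toIndex f ((T.glue a f)⁻¹ h)), swap f ((T.glue a f)⁻¹ h) * (T.glue a f)⁻¹)
  else (.inl ⟨k, ha, hb⟩, 1)

/-- `(k, h)` is the face at which the move is performed. -/
def IsMoved (k : N) (h : Fin 4) : Prop :=
  (k = a ∧ h = f) ∨ (k = T.adj a f ∧ h = T.glue a f f)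

variable {T a f}

theorem toIndex_of_ne {v : Fin 4} (h : v ≠ f) : toIndex f v = ⟨v, h⟩ := by simp [toIndex, h]

theorem newSimp_oldFace (hne : T.adj a f ≠ a) (n : NewSimp T a f) (h : Fin 4)
    (hn : ¬ IsInner T a f n h) :
    newSimp T a f (oldFace T a f n h).1 (oldFace T a f n h).2.1 = (n, (oldFace T a f n h).2.2) ∧
    (oldFace T a f n h).2.2 (oldFace T a f n h).2.1 = h ∧
    ¬ IsMoved T a f (oldFace T a f n h).1 (oldFace T a f n h).2.1 := by
  rcases n with ⟨k, ha, hb⟩ | ⟨v, hv⟩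
  · simp [oldFace, newSimp, ha, hb, IsMoved]
  · by_cases hh : h = f
    · subst hh
      simp [oldFace, newSimp, hne, IsMoved, toIndex_of_ne hv, hv]
    · have : h = v := by
        by_contra h'
        exact hn ⟨hh, h'⟩
      subst this
      simp [oldFace, newSimp, IsMoved, toIndex_of_ne hv, hv, hne.symm]

theorem oldFace_newSimp (hne : T.adj a f ≠ a) (k : N) (h : Fin 4) (hk : ¬ IsMoved T a f k h) :
    oldFace T a f (newSimp T a f k h).1 ((newSimp T a f k h).2 h) =
      (k, h, (newSimp T a f k h).2) ∧
    ¬ IsInner T a f (newSimp T a f k h).1 ((newSimp T a f k h).2 h) := by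
  by_cases ha : k = a
  · subst ha
    have hf : h ≠ f := fun e => hk (Or.inl ⟨rfl, e⟩)
    simp [newSimp, oldFace, IsInner, hf, toIndex_of_ne hf]
  · by_cases hb : k = T.adj a f
    · subst hb
      obtain ⟨v, rfl⟩ := (T.glue a f).surjective h
      have hf : v ≠ f := fun e => hk (Or.inr ⟨rfl, by rw [e]⟩)
      simp [newSimp, oldFace, IsInner, hne, toIndex_of_ne hf]
    · simp [newSimp, oldFace, IsInner, ha, hb]

theorem not_isMoved_adj (k : N) (h : Fin 4) (hk : ¬ IsMoved T a f k h) :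
    ¬ IsMoved T a f (T.adj k h) (T.glue k h h) := by
  rintro (⟨h1, h2⟩ | ⟨h1, h2⟩)
  · apply hk
    right
    have e1 := T.adj_adj k h
    have e2 := T.glue_glue k h
    rw [h1, h2] at e1 e2
    refine ⟨e1.symm, ?_⟩
    rw [e2, ← h2]
    simp
  · apply hk
    left
    have e1 := T.adj_adj k h
    have e2 := T.glue_glue k h
    rw [h1, h2] at e1 e2
    rw [T.adj_adj] at e1
    rw [T.glue_glue] at e2
    refine ⟨e1.symm, ?_⟩
    have := congrArg (fun s : Perm (Fin 4) => s⁻¹ (T.glue a f f)) e2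
    simp only [inv_inv] at this
    rw [← h2] at this
    have h3 : T.glue k h h = T.glue k h ((T.glue a f)⁻¹ (T.glue a f f)) := by
      rw [h2] at this ⊢
      rw [inv_inj] at e2
      simp [← e2]
    have := (T.glue k h).injective h3
    simpa using this

variable (T a f)

open Classical in
/-- The new simplex adjacent to `n` along its face `h`, with the gluing. If the face `h` of the
simplex `v` is inner, this is the simplex `h`; its vertices are those of the simplex `v`, but the
vertex called `v` there is called `h` here, and the vertices `h` of `v` and `v` of `h` are the ones
opposite to the common face. The other faces are glued as before the move. -/
noncomputable def newAdj (n : NewSimp T a f) (h : Fin 4) : NewSimp T a f × Perm (Fin 4) :=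
  if IsInner T a f n h then
    match n with
    | .inl k => (.inl k, 1)
    | .inr v => (.inr (toIndex f h), swap h v)
  else
    let o := oldFace T a f n h
    let n' := newSimp T a f (T.adj o.1 o.2.1) (T.glue o.1 o.2.1 o.2.1)
    (n'.1, n'.2 * T.glue o.1 o.2.1 * o.2.2⁻¹)

variable {T a f}

theorem newAdj_newAdj (hne : T.adj a f ≠ a) (n : NewSimp T a f) (h : Fin 4) :
    newAdj T a f (newAdj T a f n h).1 ((newAdj T a f n h).2 h) =
      (n, (newAdj T a f n h).2⁻¹) ∧
    ¬ ((newAdj T a f n h).1 = n ∧ (newAdj T a f n h).2 h = h) := by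
  by_cases hi : IsInner T a f n h
  · rcases n with k | ⟨v, hv⟩
    · exact hi.elim
    · obtain ⟨h1, h2⟩ := hi
      simp [newAdj, IsInner, h1, h2, toIndex_of_ne h1, toIndex_of_ne hv, hv, Ne.symm h2,
        swap_comm]
  · obtain ⟨e1, e2, e3⟩ := newSimp_oldFace hne n h hi
    set o := oldFace T a f n h with ho
    have e4 := not_isMoved_adj _ _ e3
    obtain ⟨e5, e6⟩ := oldFace_newSimp hne _ _ e4
    have hA : newAdj T a f n h =
        ((newSimp T a f (T.adj o.1 o.2.1) (T.glue o.1 o.2.1 o.2.1)).1,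
         (newSimp T a f (T.adj o.1 o.2.1) (T.glue o.1 o.2.1 o.2.1)).2 *
           T.glue o.1 o.2.1 * o.2.2⁻¹) := by
      simp only [newAdj, if_neg hi, ← ho]
    have hB : (newAdj T a f n h).2 h =
        (newSimp T a f (T.adj o.1 o.2.1) (T.glue o.1 o.2.1 o.2.1)).2
          (T.glue o.1 o.2.1 o.2.1) := by
      rw [hA]
      have : o.2.2⁻¹ h = o.2.1 := by rw [← e2]; simp
      simp only [Perm.mul_apply, this]
    have hC : (newAdj T a f n h).1 =
        (newSimp T a f (T.adj o.1 o.2.1) (T.glue o.1 o.2.1 o.2.1)).1 := by rw [hA]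
    rw [hB, hC]
    constructor
    · rw [hA]
      unfold newAdj
      rw [if_neg e6]
      have e7 : (T.glue o.1 o.2.1)⁻¹ (T.glue o.1 o.2.1 o.2.1) = o.2.1 := by simp
      simp only [e5, T.adj_adj, T.glue_glue, e7, e1]
      simp [mul_assoc]
    · rintro ⟨h1, h2⟩
      have h3 := e5
      rw [h1, h2, ← ho] at h3
      have h4 : o.1 = T.adj o.1 o.2.1 := congrArg (fun z => z.1) h3
      have h5 : o.2.1 = T.glue o.1 o.2.1 o.2.1 := congrArg (fun z => z.2.1) h3
      exact T.no_self _ _ ⟨h4.symm, h5.symm⟩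

variable (T a f)

/-- The triangulation obtained by the 2-3 move at the face of `a` opposite to `f`. -/
noncomputable def Tri.move (hne : T.adj a f ≠ a) : Tri (NewSimp T a f) where
  adj n h := (newAdj T a f n h).1
  glue n h := (newAdj T a f n h).2
  adj_adj n h := congrArg Prod.fst (newAdj_newAdj hne n h).1
  glue_glue n h := congrArg Prod.snd (newAdj_newAdj hne n h).1
  no_self n h := (newAdj_newAdj hne n h).2

end Move

namespace Marked

variable (M : Marked S) (a : M.Simp) (f : Fin 4)

open Classical in
/-- Path from the anchor of the new simplices to the anchor of the old simplex `k`, if `k` is one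
of the two simplices at the face of `a` opposite to `f`; otherwise the empty path. -/
noncomputable def pathTo (k : M.Simp) : List (Fin 4) :=
  if k = M.tri.adj a f then M.lab a f else []

open Classical in
/-- The reverse of `pathTo`. -/
noncomputable def pathFrom (k : M.Simp) : List (Fin 4) :=
  if k = M.tri.adj a f then M.lab (M.tri.adj a f) (M.tri.glue a f f) else []

open Classical in
/-- The factor by which the coordinates at the old simplex `k` differ from those at the new
simplices that replace it, at the vertex called `i` in `k`. -/
noncomputable def factor (k : M.Simp) (i : Fin 4) : ℂ :=
  if k = M.tri.adj a f ∧ i ≠ M.tri.glue a f f then M.wt a ((M.tri.glue a f)⁻¹ i) f else 1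

open Classical in
/-- The 2-3 move at the face of `a` opposite to `f`, where the new simplices are lifted to the
universal cover such that they lie in the union of the lift of `a` and of the adjacent simplex. -/
noncomputable def move (hne : M.tri.adj a f ≠ a) : Marked S where
  Simp := NewSimp M.tri a f
  tri := M.tri.move a f hne
  wt n i h :=
    if IsInner M.tri a f n h then 1 else
      let o := oldFace M.tri a f n h
      (M.factor a f (M.tri.adj o.1 o.2.1) (M.tri.glue o.1 o.2.1 (o.2.2⁻¹ i)))⁻¹ *
        M.wt o.1 (o.2.2⁻¹ i) o.2.1 * M.factor a f o.1 (o.2.2⁻¹ i)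
  anchor
    | .inl k => M.anchor k
    | .inr _ => M.anchor a
  pos
    | .inl k, i => M.pos k i
    | .inr v, i =>
        if i = v then
          (M.lab a f ++ (M.pos (M.tri.adj a f) (M.tri.glue a f f)).1,
            (M.pos (M.tri.adj a f) (M.tri.glue a f f)).2)
        else M.pos a i
  lab n h :=
    if IsInner M.tri a f n h then [] else
      let o := oldFace M.tri a f n h
      M.pathTo a f o.1 ++ M.lab o.1 o.2.1 ++ M.pathFrom a f (M.tri.adj o.1 o.2.1)

/-- The partition `Z'` after a 2-3 move agrees with `Z` on the edges of the old triangulation. -/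
structure Extends (Z : Set (M.Simp × Fin 4 × Fin 4))
    (Z' : Set (NewSimp M.tri a f × Fin 4 × Fin 4)) : Prop where
  old : ∀ k (i j : Fin 4), i ≠ j → ((.inl k, i, j) ∈ Z' ↔ (k.1, i, j) ∈ Z)
  fst : ∀ (v : {v : Fin 4 // v ≠ f}) (i j : Fin 4), i ≠ j → i ≠ v → j ≠ v →
    ((.inr v, i, j) ∈ Z' ↔ (a, i, j) ∈ Z)
  snd : ∀ (v : {v : Fin 4 // v ≠ f}) (i j : Fin 4), i ≠ j → i ≠ f → j ≠ f →
    ((.inr v, i, j) ∈ Z' ↔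
      (M.tri.adj a f, M.tri.glue a f (swap f v i), M.tri.glue a f (swap f v j)) ∈ Z)

/-- A triangulation of the fixed manifold together with a partition of its edges. -/
abbrev WithPartition (S : Type u) := Σ M : Marked S, Set (M.Simp × Fin 4 × Fin 4)

/-- Replacing a partition by a descendant after a 2-3 move: as long as there are degenerate
simplices, the move is performed at a face between a degenerate and a non-degenerate simplex;
if there are none, it is performed at a degenerate face. -/
inductive Descent : WithPartition S → WithPartition S → Prop
  | wild (M : Marked S) (Z) (a : M.Simp) (f : Fin 4) (hne : M.tri.adj a f ≠ a) (Z')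
      (ha : Tri.IsDegSimplex Z a) (hb : ¬ Tri.IsDegSimplex Z (M.tri.adj a f))
      (hZ' : (M.tri.move a f hne).IsTransitivePartition Z') (hext : M.Extends a f Z Z') :
      Descent ⟨M, Z⟩ ⟨M.move a f hne, Z'⟩
  | moderate (M : Marked S) (Z) (a : M.Simp) (f : Fin 4) (hne : M.tri.adj a f ≠ a) (Z')
      (hs : ∀ k, ¬ Tri.IsDegSimplex Z k) (ha : Tri.IsDegFace Z a f)
      (hZ' : (M.tri.move a f hne).IsTransitivePartition Z') (hext : M.Extends a f Z Z') :
      Descent ⟨M, Z⟩ ⟨M.move a f hne, Z'⟩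

end Marked

namespace Tri

variable (T : Tri S)

/-- The Ptolemy variety of the transitive partition `Z`, as a subset of the affine space of
`V(M)`: the union, over the partitions without degenerate faces that arise from `Z` by 2-3 moves
and passing to descendants, of the (images of the) varieties of Ptolemy assignments that satisfy
the edge relations. If `Z` has no degenerate faces, only `Z` itself occurs. In the moderately
degenerate case all descendants occur, for the 2-3 moves at all degenerate faces. In the wildly
degenerate case one first removes all degenerate simplices by 2-3 moves (each of which allows
exactly one descendant). The result does not depend on the order of the moves. -/
def partitionVariety (t : S → Fin 4 → Fin 4 → ℂ) (Z : Set (S × Fin 4 × Fin 4)) :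
    Set (S → IdealPt → IdealPt → ℂ) :=
  {X | IsCoordinateFn T t X ∧ ∃ P : Marked.WithPartition S,
    Relation.ReflTransGen Marked.Descent ⟨T.marked t, Z⟩ P ∧
    (∀ n f, ¬ IsDegFace P.2 n f) ∧ ∃ c, P.1.IsMildPoint P.2 c ∧ HasCoordinates P.1 c X}

/-- The invariant Ptolemy variety, for factors `t`: the union of the varieties of all transitive
partitions other than the totally degenerate one. -/
def invariantWith (t : S → Fin 4 → Fin 4 → ℂ) : Set (S → IdealPt → IdealPt → ℂ) :=
  ⋃ Z ∈ T.transitivePartitions \ {totallyDegenerate S}, T.partitionVariety t Z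

/-- The canonical image in the affine space of `V(M)` of a set of (non-degenerate) Ptolemy
assignments on the triangulation. -/
def virtualImage (t : S → Fin 4 → Fin 4 → ℂ) (P : Set (S → Fin 4 → Fin 4 → ℂ)) :
    Set (S → IdealPt → IdealPt → ℂ) :=
  {X | IsCoordinateFn T t X ∧ ∃ c ∈ P, HasCoordinates (T.marked t) c X}

/-- The invariant Ptolemy variety `P̄(𝒯)`. -/
def invariantPtolemy : Set (S → IdealPt → IdealPt → ℂ) := T.invariantWith fun _ _ _ => 1

/-- The signs `s` of the face pairings that give rise to the identification signs of `P^σ(𝒯)`: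
`s_i s_j` is the product of the values of `η` on the two copies of the edge `ij`. -/
def sigmaSign (η : S → Fin 4 → Fin 4 → ℤˣ) (k : S) (i f : Fin 4) : ℤˣ :=
  ∏ j with j ≠ i ∧ j ≠ f, η k i j * η (T.adj k f) (T.glue k f i) (T.glue k f j)

theorem sigmaSign_mul {σ : S → Fin 4 → ℤˣ} {η : S → Fin 4 → Fin 4 → ℤˣ}
    (hσ : T.IsCocycle σ) (hη : IsPrimitive σ η) (k : S) (f i j : Fin 4) (hi : f ≠ i)
    (hj : f ≠ j) (hij : i ≠ j) :
    T.sigmaSign η k i f * T.sigmaSign η k j f =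
      η k i j * η (T.adj k f) (T.glue k f i) (T.glue k f j) := by
  obtain ⟨l, hl, h1, h2⟩ : ∃ l : Fin 4, [f, i, j, l].Nodup ∧
      (Finset.univ.filter fun r => r ≠ i ∧ r ≠ f) = {j, l} ∧
      (Finset.univ.filter fun r => r ≠ j ∧ r ≠ f) = {i, l} := by
    revert f i j; decide
  have hjl : j ≠ l := by rintro rfl; simp at hl
  have hil : i ≠ l := by rintro rfl; simp at hl
  have hl' : [T.glue k f f, T.glue k f i, T.glue k f j, T.glue k f l].Nodup :=
    hl.map (T.glue k f).injective
  have c1 := hη.cobdry k f i j l hl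
  have c2 := hη.cobdry (T.adj k f) _ _ _ _ hl'
  rw [hσ.ident, ← c1] at c2
  unfold sigmaSign
  rw [h1, h2, Finset.prod_pair hjl, Finset.prod_pair hil, hη.symm k i j,
    hη.symm (T.adj k f) (T.glue k f i) (T.glue k f j), ← hη.symm k i l,
    ← hη.symm (T.adj k f) (T.glue k f i) (T.glue k f l)]
  clear hσ hη hl hl' h1 h2 hjl hil
  generalize η k i j = a at *
  generalize η k j l = b at *
  generalize η k l i = c at *
  generalize η (T.adj k f) (T.glue k f i) (T.glue k f j) = a' at *
  generalize η (T.adj k f) (T.glue k f j) (T.glue k f l) = b' at *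
  generalize η (T.adj k f) (T.glue k f l) (T.glue k f i) = c' at *
  clear c1
  revert a b c a' b' c'
  decide

/-- The invariant Ptolemy variety `P̄^σ(𝒯)`. -/
def invariantSigma (η : S → Fin 4 → Fin 4 → ℤˣ) : Set (S → IdealPt → IdealPt → ℂ) :=
  T.invariantWith fun k i f => (T.sigmaSign η k i f : ℤ)

/-- The invariant enhanced Ptolemy variety `ℰP̄(𝒯)`. -/
def invariantEnhanced (wt : S → Fin 4 → Fin 4 → ℤ × ℤ) :
    Set ((S → IdealPt → IdealPt → ℂ) × (T.Cusp → ℂ) × (T.Cusp → ℂ)) :=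
  {z | (∀ s, z.2.1 s ≠ 0) ∧ (∀ s, z.2.2 s ≠ 0) ∧
    z.1 ∈ T.invariantWith (T.monomial wt z.2.1 z.2.2)}

end Tri

/-! ## Representations -/

open scoped LinearAlgebra.Projectivization MatrixGroups

abbrev SL2 : Type := SL(2, ℂ)
abbrev PSL2 : Type := PSL(2, ℂ)

/-- The subgroup `B` of upper triangular matrices. -/
def borel : Set SL2 := {A | A.1 1 0 = 0}

/-- The subgroup `P` of upper triangular matrices with ones on the diagonal. -/
def unipotent : Set SL2 := {A | ∃ z, A.1 = matX z}

/-- The image of `P` in `PSL(2, ℂ)`. -/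
def pslUnipotent : Set PSL2 := QuotientGroup.mk '' unipotent

/-- A representation in `SL(2, ℂ)` or `PSL(2, ℂ)` is irreducible if no line in `ℂ²` is invariant. -/
def IsIrreducible {Γ G : Type*} [Group Γ] [Group G] [MulAction G (ℙ ℂ (Fin 2 → ℂ))]
    (ρ : Γ →* G) : Prop := ¬ ∃ x : ℙ ℂ (Fin 2 → ℂ), ∀ γ, ρ γ • x = x

namespace Tri

variable (T : Tri S)

/-- `B` is the product of the labels of the cocycle `L` along an edge path in the truncated
complex that represents the loop `a`; all edges may be used. -/
def LoopLabel (L : Labeling S) {k : S} (a : T.Loop k) (B : Matrix (Fin 2) (Fin 2) ℂ) : Prop :=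
  Trace (T.marked 1) L (fun _ i j => i ≠ j) (k, 0, 1) (k, 0, 1) a.1 B

/-- `ρ` is, up to conjugation, the representation determined by the cocycle `L`. -/
def IsHolonomy (L : Labeling S) {k : S} (ρ : T.Pi1 k →* SL2) : Prop :=
  ∃ C : SL2, ∀ a : T.Loop k, (∃ B, T.LoopLabel L a B) ∧
    ∀ B, T.LoopLabel L a B → (ρ a.cls).1 = C.1 * B * (C⁻¹).1

/-- `ρ` is, up to conjugation, the representation in `PSL(2, ℂ)` determined by `L`. -/
def IsPSLHolonomy (L : Labeling S) {k : S} (ρ : T.Pi1 k →* PSL2) : Prop :=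
  ∃ C : PSL2, ∀ a : T.Loop k, (∃ B, T.LoopLabel L a B) ∧
    ∀ B, T.LoopLabel L a B → ∃ A : SL2, A.1 = B ∧ ρ a.cls = C * QuotientGroup.mk A * C⁻¹

/-- A `(PSL(2, ℂ), P)`-cocycle on the truncated complex together with a lift of its labels to
`SL(2, ℂ)`, where the labels of the short edges are lifted to `P`, such that the product of the
lifts around each hexagonal face is given by `σ`. -/
structure IsLiftedCocycle (σ : S → Fin 4 → ℤˣ) (L : Labeling S) : Prop where
  det_long : ∀ k i j, i ≠ j → (L.long k i j).det = 1
  short_mem : ∀ k i j l, j ≠ i → l ≠ i → ∃ z, L.short k i j l = matX z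
  cross_eq : ∀ k i f, L.cross k i f = 1
  long_inv : ∀ k i j, i ≠ j → L.long k i j * L.long k j i = 1
  triangle : ∀ k i j l m, j ≠ i → l ≠ i → m ≠ i →
    L.short k i j l * L.short k i l m = L.short k i j m
  ident_long : ∀ k f i j, i ≠ j → f ≠ i → f ≠ j →
    L.long (T.adj k f) (T.glue k f i) (T.glue k f j) = L.long k i j
  ident_short : ∀ k f i j l, j ≠ i → l ≠ i → f ≠ i → f ≠ j → f ≠ l →
    L.short (T.adj k f) (T.glue k f i) (T.glue k f j) (T.glue k f l) = L.short k i j l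
  hexagon : ∀ k f i j l, [f, i, j, l].Nodup →
    L.long k i j * L.short k j i l * L.long k j l * L.short k l j i * L.long k l i *
      L.short k i l j = (σ k f : ℤ) • (1 : Matrix (Fin 2) (Fin 2) ℂ)

/-- `ρ` has obstruction class `[σ]` (the obstruction to lifting `ρ` to a boundary-unipotent
representation in `SL(2, ℂ)`): it is given by a cocycle with obstruction cocycle `σ`. Changing the
lifts of the long edges by signs changes `σ` by an arbitrary coboundary. -/
def HasObstructionClass (σ : S → Fin 4 → ℤˣ) {k : S} (ρ : T.Pi1 k →* PSL2) : Prop :=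
  ∃ L : Labeling S, T.IsLiftedCocycle σ L ∧ T.IsPSLHolonomy L ρ

end Tri

end Ptolemy

/-!
The only transitive partitions are the one without zero-edges and the totally degenerate one. The
invariant variety is a union over the partitions other than the latter, hence it only involves the
former, for which no 2-3 move is needed and there are no edge relations
(`Ptolemy.Tri.invariantWith_eq`). This gives the equality of the varieties.

Everything else is expressed by decorations (`Ptolemy.Tri.IsDecoration`): a vector in `ℂ²` for each
ideal vertex of each simplex, and a matrix of determinant one for each face pairing that matches
the vectors of the two simplices, up to the factors `t` that distinguish the three varieties. The
determinants of pairs of vectors of a decoration are Ptolemy coordinates, the Ptolemy relation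
being the Plücker relation, and every point of the Ptolemy variety arises in this way
(`Ptolemy.Tri.exists_isDecoration`). Developing the vectors along paths in the dual graph, one
obtains coordinates of all virtual edges (`Ptolemy.Tri.devCoords`). Thus restriction to the edges
of the triangulation is onto; it is injective since all virtual edges are reached by paths along
nonzero edges (`Ptolemy.Tri.bijOn_edgeCoords`). The product of the labels of the natural cocycle
along a path is the development of the decoration, expressed in suitable frames
(`Ptolemy.Tri.trace_eq_dev`).

Conversely, a representation of one of the three types gives a decoration by nonzero vectors. In
`SL(2, ℂ)` one transports eigenvectors of the peripheral subgroups along paths in the boundary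
(`Ptolemy.Tri.exists_isDecoration_transport`); for torus boundary, `m_s` and `l_s` are the
eigenvalues of the meridian and the longitude. In `PSL(2, ℂ)`, the signs `η` turn the lifted
cocycle into a cocycle on each single simplex, and the first columns of the matrices of which it
is the coboundary are the vectors (`Ptolemy.Tri.IsLiftedCocycle.exists_isDecoration`). Being
parallel is an equivalence relation for nonzero vectors; hence the edges with vanishing coordinate
form a transitive partition. Either no coordinate vanishes, and one has a point of the standard
Ptolemy variety, or all vectors of the decoration lie on a single line, which is invariant under
the representation (`Ptolemy.Tri.IsDecoration.exists_fixed_line`).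
-/

/-! ### Vectors in the plane -/

namespace Ptolemy

open Equiv
open scoped Matrix LinearAlgebra.Projectivization MatrixGroups

/-- The determinant of two vectors in `ℂ²`. -/
def wedge (v w : Fin 2 → ℂ) : ℂ := v 0 * w 1 - v 1 * w 0

theorem wedge_self (v : Fin 2 → ℂ) : wedge v v = 0 := by simp [wedge, mul_comm]

theorem wedge_swap (v w : Fin 2 → ℂ) : wedge w v = - wedge v w := by simp only [wedge]; ring

theorem wedge_smul_left (a : ℂ) (v w : Fin 2 → ℂ) : wedge (a • v) w = a * wedge v w := by
  simp only [wedge, Pi.smul_apply, smul_eq_mul]; ring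

theorem wedge_smul_right (a : ℂ) (v w : Fin 2 → ℂ) : wedge v (a • w) = a * wedge v w := by
  simp only [wedge, Pi.smul_apply, smul_eq_mul]; ring

theorem wedge_mulVec (A : Matrix (Fin 2) (Fin 2) ℂ) (v w : Fin 2 → ℂ) :
    wedge (A *ᵥ v) (A *ᵥ w) = A.det * wedge v w := by
  simp only [wedge, Matrix.mulVec, dotProduct, Fin.sum_univ_two, Matrix.det_fin_two]; ring

theorem wedge_plucker (a b c d : Fin 2 → ℂ) :
    wedge a d * wedge b c + wedge a b * wedge c d = wedge a c * wedge b d := by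
  simp only [wedge]; ring

theorem wedge_smul_eq (a b c : Fin 2 → ℂ) :
    wedge a b • c = wedge c b • a + wedge a c • b := by
  ext r
  fin_cases r <;>
    simp only [wedge, Pi.smul_apply, Pi.add_apply, smul_eq_mul, Fin.zero_eta, Fin.mk_one] <;> ring

theorem exists_eq_smul_of_wedge_eq_zero {a b : Fin 2 → ℂ} (hb : b ≠ 0) (h : wedge a b = 0) :
    ∃ z : ℂ, a = z • b := by
  have key : ∀ r, b r • a = a r • b := by
    intro r
    ext s
    fin_cases r <;> fin_cases s <;> simp [wedge] at h ⊢ <;>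
      first | ring1 | linear_combination h | linear_combination -h
  obtain ⟨r, hr⟩ := Function.ne_iff.mp hb
  refine ⟨(b r)⁻¹ * a r, ?_⟩
  rw [mul_smul, ← key r, smul_smul, inv_mul_cancel₀ hr, one_smul]

theorem wedge_eq_zero_trans {a b c : Fin 2 → ℂ} (hb : b ≠ 0) (h1 : wedge a b = 0)
    (h2 : wedge b c = 0) : wedge a c = 0 := by
  have h := wedge_smul_eq a b c
  rw [wedge_swap b c, h1, h2] at h
  simp only [zero_smul, neg_zero, zero_add] at h
  exact (smul_eq_zero.mp h.symm).resolve_right hb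

/-- A matrix is scalar if two independent vectors are eigenvectors with the same eigenvalue. -/
theorem eq_smul_one_of_mulVec_eq {A : Matrix (Fin 2) (Fin 2) ℂ} {a b : Fin 2 → ℂ} {z : ℂ}
    (hab : wedge a b ≠ 0) (ha : A *ᵥ a = z • a) (hb : A *ᵥ b = z • b) :
    A = z • (1 : Matrix (Fin 2) (Fin 2) ℂ) := by
  have key : ∀ x, A *ᵥ x = z • x := by
    intro x
    have h := congrArg (fun y => A *ᵥ y) (wedge_smul_eq a b x)
    simp only [Matrix.mulVec_add, Matrix.mulVec_smul, ha, hb] at h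
    rw [smul_comm _ z a, smul_comm _ z b, ← smul_add, ← wedge_smul_eq, smul_comm z] at h
    exact smul_right_injective _ hab h
  apply Matrix.ext_of_mulVec_single
  intro i
  rw [key, Matrix.smul_mulVec, Matrix.one_mulVec]

/-- The matrix of determinant one with first column `v` whose second column is a multiple
of `w`, provided that `v` and `w` are independent. -/
noncomputable def frame (v w : Fin 2 → ℂ) : Matrix (Fin 2) (Fin 2) ℂ :=
  !![v 0, w 0 / wedge v w; v 1, w 1 / wedge v w]

theorem det_frame {v w : Fin 2 → ℂ} (h : wedge v w ≠ 0) : (frame v w).det = 1 := by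
  have h' : v 0 * w 1 - v 1 * w 0 ≠ 0 := h
  rw [frame, Matrix.det_fin_two_of, wedge]
  field_simp

theorem frame_mul_matQ {v w : Fin 2 → ℂ} (h : wedge v w ≠ 0) :
    frame v w * matQ (wedge v w) = frame w v := by
  rw [frame, frame, matQ, wedge_swap v w]
  ext r s
  fin_cases r <;> fin_cases s <;> simp [Matrix.mul_apply, Fin.sum_univ_two] <;> field_simp

theorem frame_mul_matX {v w x : Fin 2 → ℂ} (h : wedge v w ≠ 0) (h' : wedge v x ≠ 0) :
    frame v w * matX (wedge w x / (wedge w v * wedge v x)) = frame v x := by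
  have e := fun r => congrFun (wedge_smul_eq v w x) r
  simp only [Pi.smul_apply, Pi.add_apply, smul_eq_mul] at e
  rw [frame, frame, matX, wedge_swap v w]
  ext r s
  fin_cases r <;> fin_cases s <;> simp [Matrix.mul_apply, Fin.sum_univ_two]
  · have := e 0
    rw [wedge_swap w x] at this
    field_simp
    linear_combination -this
  · have := e 1
    rw [wedge_swap w x] at this
    field_simp
    linear_combination -this

theorem frame_mul_matD (v w : Fin 2 → ℂ) {a b : ℂ} (ha : a ≠ 0) (hb : b ≠ 0) :
    frame v w * matD a = frame (a • v) (b • w) := by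
  rw [frame, frame, matD, wedge_smul_left, wedge_smul_right]
  ext r s
  fin_cases r <;> fin_cases s <;> simp [Matrix.mul_apply, Fin.sum_univ_two] <;> field_simp

theorem mul_frame {A : Matrix (Fin 2) (Fin 2) ℂ} (hA : A.det = 1) (v w : Fin 2 → ℂ) :
    A * frame v w = frame (A *ᵥ v) (A *ᵥ w) := by
  rw [frame, frame, wedge_mulVec, hA, one_mul]
  ext r s
  fin_cases r <;> fin_cases s <;>
    simp [Matrix.mul_apply, Fin.sum_univ_two, Matrix.mulVec, dotProduct] <;> ring

/-- If `frame v w * B = X * frame v' w'`, the lower left entry of `B` is the determinant of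
the first columns. -/
theorem lower_left_eq_wedge {v w v' w' : Fin 2 → ℂ} {B X : Matrix (Fin 2) (Fin 2) ℂ}
    (h : wedge v w ≠ 0) (hB : frame v w * B = X * frame v' w') :
    B 1 0 = wedge v (X *ᵥ v') := by
  have hd := det_frame h
  rw [Matrix.det_fin_two] at hd
  have e0 := congrFun (congrFun hB 0) 0
  have e1 := congrFun (congrFun hB 1) 0
  simp [frame, Matrix.mul_apply, Fin.sum_univ_two] at e0 e1 hd
  simp only [wedge, Matrix.mulVec, dotProduct, Fin.sum_univ_two] at *
  rw [← e0, ← e1]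
  linear_combination -(B 1 0) * hd

/-- Two families of vectors with the same determinants of pairs, not all zero, are related by a
matrix of determinant one. -/
theorem exists_matrix {ι : Type*} {v w : ι → Fin 2 → ℂ} {p : ι → Prop}
    (h : ∀ i j, p i → p j → wedge (v i) (v j) = wedge (w i) (w j))
    {i j : ι} (hi : p i) (hj : p j) (hij : wedge (v i) (v j) ≠ 0) :
    ∃ A : Matrix (Fin 2) (Fin 2) ℂ, A.det = 1 ∧ ∀ l, p l → A *ᵥ v l = w l := by
  have hij' : wedge (w i) (w j) ≠ 0 := h i j hi hj ▸ hij
  have hv := det_frame hij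
  have hw := det_frame hij'
  have hu : IsUnit (frame (v i) (v j)).det := by rw [hv]; exact isUnit_one
  set A := frame (w i) (w j) * (frame (v i) (v j))⁻¹ with hA
  have hdet : A.det = 1 := by
    rw [hA, Matrix.det_mul, Matrix.det_nonsing_inv, hv, hw]; simp
  have hmul : A * frame (v i) (v j) = frame (w i) (w j) := by
    rw [hA, Matrix.mul_assoc, Matrix.nonsing_inv_mul _ hu, Matrix.mul_one]
  have c1 : A *ᵥ v i = w i := by
    have := fun r => congrFun (congrFun hmul r) 0
    ext r
    have e := this r
    fin_cases r <;>
      simpa [frame, Matrix.mul_apply, Fin.sum_univ_two, Matrix.mulVec, dotProduct] using e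
  have c2 : A *ᵥ v j = w j := by
    have := fun r => congrFun (congrFun hmul r) 1
    ext r
    have e := this r
    have hx := h i j hi hj
    fin_cases r <;>
      simp [frame, Matrix.mul_apply, Fin.sum_univ_two, Matrix.mulVec, dotProduct, hx] at e ⊢ <;>
      field_simp at e <;> exact e
  refine ⟨A, hdet, fun l hl => ?_⟩
  have e := congrArg (fun y => A *ᵥ y) (wedge_smul_eq (v i) (v j) (v l))
  simp only [Matrix.mulVec_add, Matrix.mulVec_smul, c1, c2] at e
  rw [h i j hi hj, h l j hl hj, h i l hi hl, ← wedge_smul_eq] at e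
  exact smul_right_injective _ hij' e

variable {S : Type u}

namespace Tri

/-! ### Decorations and their development -/

variable {T : Tri S}

/-- The properties of the factors `t k i f` attached to moving the vertex `i` of `k` through the
face opposite to `f` that make the coordinates of virtual edges well-defined: they are invertible,
crossing back and forth has no effect, and the product around an edge is a sign. -/
structure IsCrossingFactor (T : Tri S) (t : S → Fin 4 → Fin 4 → ℂ) : Prop where
  ne_zero : ∀ k i f, t k i f ≠ 0
  back : ∀ k i f, i ≠ f → t k i f * t (T.adj k f) (T.glue k f i) (T.glue k f f) = 1
  loop : ∀ x : S × Perm (Fin 4), (∏ n ∈ Finset.range (T.edgeDeg x),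
    t (T.rot^[n] x).1 ((T.rot^[n] x).2 0) ((T.rot^[n] x).2 2)) ^ 2 = 1

/-- A decoration, described in local terms: a vector `v k i` for each ideal vertex of each simplex,
and a matrix `A k f` of determinant one for each face pairing, which takes the vectors of the
adjacent simplex to those of `k`, up to the factors `t`. -/
structure IsDecoration (T : Tri S) (t : S → Fin 4 → Fin 4 → ℂ) (v : S → Fin 4 → Fin 2 → ℂ)
    (A : S → Fin 4 → Matrix (Fin 2) (Fin 2) ℂ) : Prop where
  det_eq_one : ∀ k f, (A k f).det = 1
  mulVec_eq : ∀ k f i, f ≠ i → A k f *ᵥ v (T.adj k f) (T.glue k f i) = t k i f • v k i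

/-- The Ptolemy coordinates of a decoration. -/
def wedgeCoords (v : S → Fin 4 → Fin 2 → ℂ) (k : S) (i j : Fin 4) : ℂ := wedge (v k i) (v k j)

/-- The product of the matrices `A` along a path in the dual graph. -/
def dev (T : Tri S) (A : S → Fin 4 → Matrix (Fin 2) (Fin 2) ℂ) :
    S → List (Fin 4) → Matrix (Fin 2) (Fin 2) ℂ
  | _, [] => 1
  | k, f :: w => A k f * dev T A (T.adj k f) w

theorem dev_append (A : S → Fin 4 → Matrix (Fin 2) (Fin 2) ℂ) (k : S) (p q : List (Fin 4)) :
    T.dev A k (p ++ q) = T.dev A k p * T.dev A (T.endpt k p) q := by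
  induction p generalizing k with
  | nil => simp [dev, endpt]
  | cons f p ih =>
    rw [List.cons_append, dev, dev, ih, Matrix.mul_assoc]
    rfl

theorem endpt_concat (k : S) (p : List (Fin 4)) (f : Fin 4) :
    T.endpt k (p ++ [f]) = T.adj (T.endpt k p) f := by
  rw [endpt_append]; rfl

theorem dev_concat (A : S → Fin 4 → Matrix (Fin 2) (Fin 2) ℂ) {k n : S} {p : List (Fin 4)}
    (h : T.endpt k p = n) (f : Fin 4) : T.dev A k (p ++ [f]) = T.dev A k p * A n f := by
  rw [dev_append, h, dev, dev, Matrix.mul_one]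

theorem rot_snd_of_ne (x : S × Perm (Fin 4)) {a : Fin 4} (h2 : a ≠ 2) (h3 : a ≠ 3) :
    (T.rot x).2 a = T.glue x.1 (x.2 2) (x.2 a) := by
  simp [rot, swap_apply_of_ne_of_ne h2 h3]

theorem endpt_rot (x : S × Perm (Fin 4)) (n : ℕ) :
    T.endpt x.1 ((List.range n).map fun m => (T.rot^[m] x).2 2) = (T.rot^[n] x).1 := by
  induction n with
  | zero => rfl
  | succ n ih =>
    rw [List.range_succ, List.map_append, List.map_singleton, endpt_concat, ih,
      Function.iterate_succ_apply']
    rfl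

theorem rot_iterate_edgeDeg (x : S × Perm (Fin 4)) : T.rot^[T.edgeDeg x] x = x :=
  Function.iterate_minimalPeriod

theorem endpt_edgeLoop (x : S × Perm (Fin 4)) : T.endpt x.1 (T.edgeLoop x) = x.1 := by
  rw [edgeLoop, endpt_rot, rot_iterate_edgeDeg]

section Decoration

variable {t : S → Fin 4 → Fin 4 → ℂ} {v : S → Fin 4 → Fin 2 → ℂ}
  {A : S → Fin 4 → Matrix (Fin 2) (Fin 2) ℂ}

theorem IsDecoration.det_dev (h : T.IsDecoration t v A) (k : S) (w : List (Fin 4)) :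
    (T.dev A k w).det = 1 := by
  induction w generalizing k with
  | nil => simp [dev]
  | cons f w ih => rw [dev, Matrix.det_mul, h.det_eq_one, ih, one_mul]

theorem IsDecoration.isPtolemy (h : T.IsDecoration t v A) :
    T.IsPtolemy (fun k f i j => t k i f * t k j f) (wedgeCoords v) where
  orient k i j := wedge_swap _ _
  ident k f i j hi hj := by
    have e := wedge_mulVec (A k f) (v (T.adj k f) (T.glue k f i)) (v (T.adj k f) (T.glue k f j))
    rw [h.det_eq_one, one_mul, h.mulVec_eq k f i hi, h.mulVec_eq k f j hj, wedge_smul_left,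
      wedge_smul_right] at e
    rw [wedgeCoords, ← e, wedgeCoords, mul_assoc]
  ptolemy k := wedge_plucker _ _ _ _

theorem IsDecoration.dev_rot (h : T.IsDecoration t v A) (x : S × Perm (Fin 4)) {a : Fin 4}
    (h2 : a ≠ 2) (h3 : a ≠ 3) (n : ℕ) :
    T.dev A x.1 ((List.range n).map fun m => (T.rot^[m] x).2 2) *ᵥ
        v (T.rot^[n] x).1 ((T.rot^[n] x).2 a) =
      (∏ m ∈ Finset.range n, t (T.rot^[m] x).1 ((T.rot^[m] x).2 a) ((T.rot^[m] x).2 2)) •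
        v x.1 (x.2 a) := by
  induction n with
  | zero => simp [dev]
  | succ n ih =>
    rw [List.range_succ, List.map_append, List.map_singleton, dev_append, endpt_rot,
      Function.iterate_succ_apply', rot_snd_of_ne _ h2 h3, ← Matrix.mulVec_mulVec, dev, dev,
      Matrix.mul_one]
    change _ *ᵥ (_ *ᵥ v (T.adj _ _) _) = _
    rw [h.mulVec_eq _ _ _ (fun e => h2 ((T.rot^[n] x).2.injective e.symm)), Matrix.mulVec_smul, ih,
      smul_smul, Finset.prod_range_succ, mul_comm]

/-- Developing a decoration around an edge gives a scalar matrix: the two vectors at the ends of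
the edge are eigenvectors, and the eigenvalues agree since they are signs with product `1`. -/
theorem IsDecoration.dev_edgeLoop (h : T.IsDecoration t v A) (ht : T.IsCrossingFactor t)
    (hv : ∀ k i j, i ≠ j → wedgeCoords v k i j ≠ 0) (x : S × Perm (Fin 4)) :
    T.dev A x.1 (T.edgeLoop x) = (∏ n ∈ Finset.range (T.edgeDeg x),
      t (T.rot^[n] x).1 ((T.rot^[n] x).2 0) ((T.rot^[n] x).2 2)) •
        (1 : Matrix (Fin 2) (Fin 2) ℂ) := by
  have e0 := h.dev_rot x (a := 0) (by decide) (by decide) (T.edgeDeg x)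
  have e1 := h.dev_rot x (a := 1) (by decide) (by decide) (T.edgeDeg x)
  rw [rot_iterate_edgeDeg] at e0 e1
  have hne : wedge (v x.1 (x.2 0)) (v x.1 (x.2 1)) ≠ 0 :=
    hv _ _ _ (fun e => absurd (x.2.injective e) (by decide))
  have hs := ht.loop x
  refine eq_smul_one_of_mulVec_eq hne e0 (e1.trans ?_)
  have hd := wedge_mulVec (T.dev A x.1 (T.edgeLoop x)) (v x.1 (x.2 0)) (v x.1 (x.2 1))
  rw [h.det_dev, one_mul, edgeLoop, e0, e1, wedge_smul_left, wedge_smul_right] at hd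
  generalize (∏ n ∈ Finset.range (T.edgeDeg x),
      t (T.rot^[n] x).1 ((T.rot^[n] x).2 0) ((T.rot^[n] x).2 2)) = a at *
  generalize (∏ n ∈ Finset.range (T.edgeDeg x),
      t (T.rot^[n] x).1 ((T.rot^[n] x).2 1) ((T.rot^[n] x).2 2)) = b at *
  have hab : a * b = 1 := by
    refine mul_right_cancel₀ hne ?_
    rw [one_mul, mul_assoc, hd]
  have : b = a := by linear_combination a * hab - b * hs
  rw [this]

theorem IsDecoration.mul_back (h : T.IsDecoration t v A) (ht : T.IsCrossingFactor t)
    (hv : ∀ k i j, i ≠ j → wedgeCoords v k i j ≠ 0) (k : S) (f : Fin 4) :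
    A k f * A (T.adj k f) (T.glue k f f) = 1 := by
  have key : ∀ i, f ≠ i → (A k f * A (T.adj k f) (T.glue k f f)) *ᵥ v k i = (1 : ℂ) • v k i := by
    intro i hi
    have e := h.mulVec_eq (T.adj k f) (T.glue k f f) (T.glue k f i)
      (fun e => hi ((T.glue k f).injective e))
    rw [T.adj_adj, T.glue_glue, Perm.coe_inv, Equiv.symm_apply_apply] at e
    rw [← Matrix.mulVec_mulVec, e, Matrix.mulVec_smul, h.mulVec_eq k f i hi, smul_smul, mul_comm,
      ht.back k i f hi.symm]
  obtain ⟨i, j, hi, hj, hij⟩ : ∃ i j : Fin 4, f ≠ i ∧ f ≠ j ∧ i ≠ j := by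
    clear key
    revert f; decide
  have := eq_smul_one_of_mulVec_eq (hv k i j hij) (key i hi) (key j hj)
  rwa [one_smul] at this

/-- The determinants of the vectors of a decoration, developed along paths. -/
def devCoords (T : Tri S) (v : S → Fin 4 → Fin 2 → ℂ) (A : S → Fin 4 → Matrix (Fin 2) (Fin 2) ℂ)
    (k : S) (x y : IdealPt) : ℂ :=
  wedge (T.dev A k x.1 *ᵥ v (T.endpt k x.1) x.2) (T.dev A k y.1 *ᵥ v (T.endpt k y.1) y.2)

theorem IsDecoration.isCoordinateFn (h : T.IsDecoration t v A) (ht : T.IsCrossingFactor t)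
    (hv : ∀ k i j, i ≠ j → wedgeCoords v k i j ≠ 0) :
    IsCoordinateFn T t (T.devCoords v A) := by
  have slide : ∀ k p i f, i ≠ f →
      T.dev A k (p ++ [f]) *ᵥ v (T.endpt k (p ++ [f])) (T.glue (T.endpt k p) f i) =
        t (T.endpt k p) i f • (T.dev A k p *ᵥ v (T.endpt k p) i) := by
    intro k p i f hif
    rw [dev_append, endpt_concat, dev, dev, Matrix.mul_one, ← Matrix.mulVec_mulVec,
      h.mulVec_eq _ _ _ hif.symm, Matrix.mulVec_smul]
  have back : ∀ k p f q,
      T.dev A k (p ++ [f, T.glue (T.endpt k p) f f] ++ q) = T.dev A k (p ++ q) ∧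
      T.endpt k (p ++ [f, T.glue (T.endpt k p) f f] ++ q) = T.endpt k (p ++ q) := by
    intro k p f q
    have e1 : T.dev A (T.endpt k p) [f, T.glue (T.endpt k p) f f] = 1 := by
      rw [dev, dev, dev, Matrix.mul_one]
      exact h.mul_back ht hv _ _
    have e2 : T.endpt (T.endpt k p) [f, T.glue (T.endpt k p) f f] = T.endpt k p := T.adj_adj _ _
    constructor
    · rw [List.append_assoc, dev_append, dev_append, dev_append, e1, e2, Matrix.one_mul]
    · rw [List.append_assoc, endpt_append, endpt_append, endpt_append, e2]
  have loop : ∀ k p (x : S × Perm (Fin 4)) q, x.1 = T.endpt k p →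
      T.dev A k (p ++ T.edgeLoop x ++ q) = (∏ n ∈ Finset.range (T.edgeDeg x),
        t (T.rot^[n] x).1 ((T.rot^[n] x).2 0) ((T.rot^[n] x).2 2)) • T.dev A k (p ++ q) ∧
      T.endpt k (p ++ T.edgeLoop x ++ q) = T.endpt k (p ++ q) := by
    intro k p x q hx
    constructor
    · rw [List.append_assoc, dev_append, dev_append, dev_append, ← hx, endpt_edgeLoop,
        h.dev_edgeLoop ht hv, Matrix.smul_mul, Matrix.one_mul, Matrix.mul_smul]
    · rw [List.append_assoc, endpt_append, endpt_append, endpt_append, ← hx, endpt_edgeLoop]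
  constructor
  · intro k f p q i j
    simp only [devCoords, dev]
    rw [← Matrix.mulVec_mulVec, ← Matrix.mulVec_mulVec, wedge_mulVec, h.det_eq_one, one_mul]
    rfl
  · intro k p i f y hif
    simp only [devCoords]
    rw [slide k p i f hif, wedge_smul_left]
  · intro k p i f y hif
    simp only [devCoords]
    rw [slide k p i f hif, wedge_smul_right]
  · intro k p f q i y
    simp only [devCoords]
    rw [(back k p f q).1, (back k p f q).2]
  · intro k p f q i y
    simp only [devCoords]
    rw [(back k p f q).1, (back k p f q).2]
  · intro k p x q i y hx
    simp only [devCoords]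
    rw [(loop k p x q hx).1, (loop k p x q hx).2, Matrix.smul_mulVec, wedge_smul_left]
  · intro k p x q i y hx
    simp only [devCoords]
    rw [(loop k p x q hx).1, (loop k p x q hx).2, Matrix.smul_mulVec, wedge_smul_right]

end Decoration

/-! ### Products of labels along edge paths -/

/-- If frames `G` at the vertices of the truncated simplices are related by the labels `L` and the
face pairing matrices `A`, up to scalars in `U`, then the product of the labels along an edge path
is the development along the underlying path, expressed in the frames at its ends. -/
theorem trace_eq_dev {t : S → Fin 4 → Fin 4 → ℂ} {L : Labeling S} {ok : S → Fin 4 → Fin 4 → Prop}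
    {G : S → Fin 4 → Fin 4 → Matrix (Fin 2) (Fin 2) ℂ} {A : S → Fin 4 → Matrix (Fin 2) (Fin 2) ℂ}
    (U : Submonoid ℂ)
    (hlong : ∀ n i j, ok n i j → ok n j i → ∃ u ∈ U, G n i j * L.long n i j = u • G n j i)
    (hshort : ∀ n i j l, ok n i j → ok n i l → ∃ u ∈ U, G n i j * L.short n i j l = u • G n i l)
    (hcross : ∀ n f i j, ok n i j → f ≠ i → f ≠ j → ∃ u ∈ U, G n i j * L.cross n i f =
      u • (A n f * G (T.adj n f) (T.glue n f i) (T.glue n f j)))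
    {x y : (T.marked t).Simp × Fin 4 × Fin 4} {w : List (Fin 4)} {B : Matrix (Fin 2) (Fin 2) ℂ}
    (h : Trace (T.marked t) L ok x y w B) :
    T.endpt x.1 w = y.1 ∧ ok y.1 y.2.1 y.2.2 ∧
      ∃ u ∈ U, G x.1 x.2.1 x.2.2 * B = u • (T.dev A x.1 w * G y.1 y.2.1 y.2.2) := by
  induction h with
  | start h1 h2 => exact ⟨rfl, h2, 1, U.one_mem, by simp [dev]⟩
  | @long n i j w B _ hok ih =>
    obtain ⟨e, ok1, u, hu, hB⟩ := ih
    obtain ⟨u', hu', hl⟩ := hlong n i j ok1 hok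
    refine ⟨e, hok, u * u', U.mul_mem hu hu', ?_⟩
    dsimp only at hB ⊢
    rw [← Matrix.mul_assoc, hB, Matrix.smul_mul, Matrix.mul_assoc, hl, Matrix.mul_smul, smul_smul]
  | @short n i j w B l _ hl hok ih =>
    obtain ⟨e, ok1, u, hu, hB⟩ := ih
    obtain ⟨u', hu', hl⟩ := hshort n i j l ok1 hok
    refine ⟨e, hok, u * u', U.mul_mem hu hu', ?_⟩
    dsimp only at hB ⊢
    rw [← Matrix.mul_assoc, hB, Matrix.smul_mul, Matrix.mul_assoc, hl, Matrix.mul_smul, smul_smul]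
  | @cross n i j w B f _ hi hj hok ih =>
    obtain ⟨e, ok1, u, hu, hB⟩ := ih
    obtain ⟨u', hu', hl⟩ := hcross n f i j ok1 hi hj
    dsimp only at hB e ⊢
    change T.endpt x.1 (w ++ [f]) = T.adj n f ∧ _ ∧ ∃ u ∈ U, _ = u • (T.dev A x.1 (w ++ [f]) *
      G (T.adj n f) (T.glue n f i) (T.glue n f j))
    refine ⟨(endpt_concat _ _ _).trans (congrArg (T.adj · f) e), hok, u * u', U.mul_mem hu hu', ?_⟩
    rw [← Matrix.mul_assoc, hB, Matrix.smul_mul, Matrix.mul_assoc, hl, Matrix.mul_smul, smul_smul]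
    exact congrArg (fun Z => (u * u') • Z)
      ((Matrix.mul_assoc _ _ _).symm.trans (congrArg (· * _) (dev_concat A e f).symm))

/-- If all edges may be used, every path in the dual graph is followed by an edge path. -/
theorem exists_trace {t : S → Fin 4 → Fin 4 → ℂ} {L : Labeling S} {ok : S → Fin 4 → Fin 4 → Prop}
    (hok : ∀ n i j, i ≠ j → ok n i j) {k : S} {i j : Fin 4} (hij : i ≠ j) (w : List (Fin 4))
    {i' j' : Fin 4} (hij' : i' ≠ j') :
    ∃ B, Trace (T.marked t) L ok (k, i, j) (T.endpt k w, i', j') w B := by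
  have move : ∀ {n : S} {i₀ j₀ i j i' j' : Fin 4} {w B}, i ≠ j → i' ≠ j' →
      Trace (T.marked t) L ok (k, i₀, j₀) (n, i, j) w B →
      ∃ B, Trace (T.marked t) L ok (k, i₀, j₀) (n, i', j') w B := by
    intro n i₀ j₀ i j i' j' w B hij hij' h
    by_cases hi : i' = i
    · subst hi
      exact ⟨_, h.short j' hij'.symm (hok _ _ _ hij')⟩
    · exact ⟨_, ((h.short i' hi (hok _ _ _ (Ne.symm hi))).long (hok _ _ _ hi)).short j' hij'.symm
        (hok _ _ _ hij')⟩
  have key : ∀ (w : List (Fin 4)) {n : S} {i₁ j₁ i' j' : Fin 4} {w' B}, i₁ ≠ j₁ → i' ≠ j' →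
      Trace (T.marked t) L ok (k, i, j) (n, i₁, j₁) w' B →
      ∃ B, Trace (T.marked t) L ok (k, i, j) (T.endpt n w, i', j') (w' ++ w) B := by
    intro w
    induction w with
    | nil =>
      intro n i₁ j₁ i' j' w' B h1 h2 h
      rw [List.append_nil]
      exact move h1 h2 h
    | cons f w ih =>
      intro n i₁ j₁ i' j' w' B h1 h2 h
      obtain ⟨a, b, ha, hb, hab⟩ : ∃ a b : Fin 4, f ≠ a ∧ f ≠ b ∧ a ≠ b := by
        clear ih
        revert f; decide
      obtain ⟨B', h'⟩ := move h1 hab h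
      have hne : T.glue n f a ≠ T.glue n f b := fun e => hab ((T.glue n f).injective e)
      obtain ⟨B'', h''⟩ := ih hne h2 (h'.cross f ha hb (hok _ _ _ hne))
      refine ⟨B'', ?_⟩
      rw [List.append_cons]
      exact h''
  obtain ⟨B, h⟩ := key w hij hij' (Trace.start (M := T.marked t) (L := L) (ok := ok)
    (v := (k, i, j)) hij (hok _ _ _ hij))
  exact ⟨B, h⟩

/-- The frames of a decoration are related by the labels of the natural cocycle of its Ptolemy
coordinates. -/
theorem IsDecoration.natural_trace {t t' : S → Fin 4 → Fin 4 → ℂ} {v : S → Fin 4 → Fin 2 → ℂ}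
    {A : S → Fin 4 → Matrix (Fin 2) (Fin 2) ℂ} (h : T.IsDecoration t v A)
    (ht : ∀ k i f, t k i f ≠ 0) {ok : S → Fin 4 → Fin 4 → Prop}
    (hok : ∀ k i j, ok k i j → wedgeCoords v k i j ≠ 0)
    {x y : (T.marked t').Simp × Fin 4 × Fin 4} {w : List (Fin 4)}
    {B : Matrix (Fin 2) (Fin 2) ℂ}
    (hB : Trace (T.marked t') (naturalCocycle t (wedgeCoords v)) ok x y w B) :
    T.endpt x.1 w = y.1 ∧ ok y.1 y.2.1 y.2.2 ∧
      frame (v x.1 x.2.1) (v x.1 x.2.2) * B =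
        T.dev A x.1 w * frame (v y.1 y.2.1) (v y.1 y.2.2) := by
  have := trace_eq_dev (T := T) (A := A) (G := fun k i j => frame (v k i) (v k j)) ⊥
    (fun n i j h1 _ => ⟨1, Submonoid.one_mem _, by
      rw [one_smul]; exact frame_mul_matQ (hok _ _ _ h1)⟩)
    (fun n i j l h1 h2 => ⟨1, Submonoid.one_mem _, by
      rw [one_smul]; exact frame_mul_matX (hok _ _ _ h1) (hok _ _ _ h2)⟩)
    (fun n f i j h1 hi hj => ⟨1, Submonoid.one_mem _, by
      rw [one_smul, mul_frame (h.det_eq_one _ _), h.mulVec_eq _ _ _ hi, h.mulVec_eq _ _ _ hj]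
      exact frame_mul_matD _ _ (ht _ _ _) (ht _ _ _)⟩) hB
  obtain ⟨e1, e2, u, hu, e3⟩ := this
  rw [Submonoid.mem_bot] at hu
  rw [hu, one_smul] at e3
  exact ⟨e1, e2, e3⟩

theorem trace_start_ok {M : Marked S} {L : Labeling M.Simp} {ok : M.Simp → Fin 4 → Fin 4 → Prop}
    {x y : M.Simp × Fin 4 × Fin 4} {w : List (Fin 4)} {B : Matrix (Fin 2) (Fin 2) ℂ}
    (h : Trace M L ok x y w B) : ok x.1 x.2.1 x.2.2 := by
  induction h with
  | start _ h => exact h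
  | long _ _ ih => exact ih
  | short _ _ _ _ ih => exact ih
  | cross _ _ _ _ _ ih => exact ih

theorem IsDecoration.hasCoordinates {t : S → Fin 4 → Fin 4 → ℂ} {v : S → Fin 4 → Fin 2 → ℂ}
    {A : S → Fin 4 → Matrix (Fin 2) (Fin 2) ℂ} (h : T.IsDecoration t v A)
    (ht : ∀ k i f, t k i f ≠ 0) :
    HasCoordinates (T.marked t) (wedgeCoords v) (T.devCoords v A) := by
  intro n i j n' i' j' w B hB
  obtain ⟨e1, -, e3⟩ := h.natural_trace ht (fun _ _ _ h => h) hB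
  dsimp only at e1 e3
  rw [lower_left_eq_wedge (trace_start_ok hB) e3]
  change wedge ((1 : Matrix (Fin 2) (Fin 2) ℂ) *ᵥ v n i)
    (T.dev A n (w ++ []) *ᵥ v (T.endpt n (w ++ [])) i') = _
  rw [List.append_nil, e1, Matrix.one_mulVec]

theorem IsPtolemy.apply_self {θ : S → Fin 4 → Fin 4 → Fin 4 → ℂ} {c : S → Fin 4 → Fin 4 → ℂ}
    (hc : T.IsPtolemy θ c) (k : S) (i : Fin 4) : c k i i = 0 := by
  have := hc.orient k i i
  linear_combination this / 2

/-- Every non-degenerate Ptolemy assignment comes from a decoration. -/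
theorem exists_isDecoration {t : S → Fin 4 → Fin 4 → ℂ} {c : S → Fin 4 → Fin 4 → ℂ}
    (hc : c ∈ T.ptolemyWith fun k f i j => t k i f * t k j f) :
    ∃ v A, T.IsDecoration t v A ∧ wedgeCoords v = c := by
  obtain ⟨hP, hne⟩ := hc
  -- The vectors are normalized such that the first is `(1, 0)` and the second is `(0, c₀₁)`; the
  -- others are then determined by their determinants with these.
  have hself := hP.apply_self
  have hcoords : ∀ k i j, wedge ![-c k 1 i / c k 0 1, c k 0 i] ![-c k 1 j / c k 0 1, c k 0 j] =
      c k i j := by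
    intro k i j
    have h01 := hne k 0 1 (by decide)
    have hp := hP.ptolemy k
    have o10 := hP.orient k 0 1
    have o20 := hP.orient k 0 2
    have o30 := hP.orient k 0 3
    have o21 := hP.orient k 1 2
    have o31 := hP.orient k 1 3
    have o32 := hP.orient k 2 3
    fin_cases i <;> fin_cases j <;> simp [wedge, hself, o10, o20, o30, o21, o31, o32] <;>
      field_simp <;> first | ring1 | linear_combination hp | linear_combination -hp
  set v : S → Fin 4 → Fin 2 → ℂ := fun k i => ![-c k 1 i / c k 0 1, c k 0 i] with hv
  have hA : ∀ k f, ∃ A : Matrix (Fin 2) (Fin 2) ℂ, A.det = 1 ∧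
      ∀ i, f ≠ i → A *ᵥ v (T.adj k f) (T.glue k f i) = t k i f • v k i := by
    intro k f
    obtain ⟨i, j, hi, hj, hij⟩ : ∃ i j : Fin 4, f ≠ i ∧ f ≠ j ∧ i ≠ j := by
      revert f; decide
    refine exists_matrix (p := fun i => f ≠ i) ?_ hi hj ?_
    · intro i j hi hj
      rw [wedge_smul_left, wedge_smul_right]
      simp only [hv, hcoords]
      rw [hP.ident k f i j hi hj, mul_assoc]
    · simp only [hv, hcoords]
      exact hne _ _ _ fun e => hij ((T.glue k f).injective e)
  choose A hA1 hA2 using hA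
  exact ⟨v, A, ⟨hA1, hA2⟩, by ext k i j; exact hcoords k i j⟩

/-! ### Restriction to the edges of the triangulation -/

section Coordinates

variable {t : S → Fin 4 → Fin 4 → ℂ} {c : S → Fin 4 → Fin 4 → ℂ} {X Y : S → IdealPt → IdealPt → ℂ}

theorem edgeCoords_eq (hc : c ∈ T.ptolemyWith fun k f i j => t k i f * t k j f)
    (hX : HasCoordinates (T.marked t) c X) : edgeCoords X = c := by
  ext k i j
  by_cases hij : i = j
  · subst hij
    obtain ⟨j, hj⟩ := exists_ne i
    replace hj := hj.symm
    have := hX k i j k i j _ _ (Trace.start (M := T.marked t) (v := (k, i, j)) hj (hc.2 k i j hj))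
    rw [hc.1.apply_self]
    exact this.trans (by simp)
  · have h1 := hc.2 k i j hij
    have h2 := hc.2 k j i (Ne.symm hij)
    have := hX k i j k j i _ _
      ((Trace.start (M := T.marked t) (v := (k, i, j)) hij h1).long h2)
    exact this.trans (by rw [Matrix.one_mul]; simp [naturalCocycle, matQ])

theorem IsCoordinateFn.apply_append_rev (h : IsCoordinateFn T t X) (k : S) (y : IdealPt)
    (p r q : List (Fin 4)) (j : Fin 4) :
    X k y (r ++ p ++ T.rev (T.endpt k r) p ++ q, j) = X k y (r ++ q, j) := by
  induction p generalizing r q with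
  | nil => simp [rev]
  | cons f p ih =>
    have e := ih (r ++ [f]) ([T.glue (T.endpt k r) f f] ++ q)
    rw [endpt_concat] at e
    have b := h.back_right k r f q j y
    simp only [rev, List.append_assoc, List.cons_append, List.nil_append] at e b ⊢
    rw [e, b]

theorem IsCoordinateFn.anchor_append (h : IsCoordinateFn T t X) (k : S) (r p q : List (Fin 4))
    (i j : Fin 4) : X k (r ++ p, i) (r ++ q, j) = X (T.endpt k r) (p, i) (q, j) := by
  induction r generalizing k with
  | nil => rfl
  | cons f r ih => exact (h.anchor k f _ _ i j).trans (ih _)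

/-- All coordinates of virtual edges are determined by the Ptolemy coordinates. -/
theorem eq_of_hasCoordinates (hc : c ∈ T.ptolemyWith fun k f i j => t k i f * t k j f)
    (hX : IsCoordinateFn T t X) (hY : IsCoordinateFn T t Y)
    (hXc : HasCoordinates (T.marked t) c X) (hYc : HasCoordinates (T.marked t) c Y) : X = Y := by
  have key : ∀ k i u j, X k ([], i) (u, j) = Y k ([], i) (u, j) := by
    intro k i u j
    obtain ⟨i', hi'⟩ := exists_ne i
    obtain ⟨j', hj'⟩ := exists_ne j
    obtain ⟨B, hB⟩ := exists_trace (T := T) (t := t) (L := naturalCocycle t c)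
      (ok := fun n i j => c n i j ≠ 0) (k := k) hc.2 hi'.symm u hj'.symm
    have e1 := hXc _ _ _ _ _ _ _ _ hB
    have e2 := hYc _ _ _ _ _ _ _ _ hB
    have e3 := e1.trans e2.symm
    change X k ([], i) (u ++ [], j) = Y k ([], i) (u ++ [], j) at e3
    rwa [List.append_nil] at e3
  -- Every virtual edge is seen from a simplex that has one of its ends as a vertex.
  have main : ∀ {X}, IsCoordinateFn T t X → ∀ k p i q j,
      X k (p, i) (q, j) = X (T.endpt k p) ([], i) (T.rev k p ++ q, j) := by
    intro X hX k p i q j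
    have e1 := IsCoordinateFn.apply_append_rev hX k (p, i) p [] q j
    have e2 := IsCoordinateFn.anchor_append hX k p [] (T.rev k p ++ q) i j
    simp only [List.nil_append, List.append_nil, List.append_assoc] at e1 e2
    rw [← e2]
    exact e1.symm
  ext k ⟨p, i⟩ ⟨q, j⟩
  rw [main hX, main hY, key]

theorem bijOn_edgeCoords (ht : T.IsCrossingFactor t) :
    Set.BijOn edgeCoords
      (T.virtualImage t (T.ptolemyWith fun k f i j => t k i f * t k j f))
      (T.ptolemyWith fun k f i j => t k i f * t k j f) := by
  refine ⟨?_, ?_, ?_⟩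
  · rintro X ⟨-, c, hc, hXc⟩
    rwa [edgeCoords_eq hc hXc]
  · rintro X ⟨hX, c, hc, hXc⟩ Y ⟨hY, d, hd, hYd⟩ h
    rw [edgeCoords_eq hc hXc, edgeCoords_eq hd hYd] at h
    subst h
    exact eq_of_hasCoordinates hc hX hY hXc hYd
  · intro c hc
    obtain ⟨v, A, h, rfl⟩ := exists_isDecoration hc
    exact ⟨_, ⟨h.isCoordinateFn ht hc.2, _, hc, h.hasCoordinates ht.ne_zero⟩,
      edgeCoords_eq hc (h.hasCoordinates ht.ne_zero)⟩

end Coordinates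

/-! ### Partitions and the invariant varieties -/

theorem isTransitivePartition_empty (T : Tri S) : T.IsTransitivePartition ∅ := by
  constructor <;> simp

theorem isTransitivePartition_totallyDegenerate (T : Tri S) :
    T.IsTransitivePartition (totallyDegenerate S) where
  ne _ _ _ h := h
  symm _ _ _ h := Ne.symm h
  ident k f _ _ _ _ := (T.glue k f).injective.ne_iff
  trans _ _ _ _ h _ _ := h

/-- If there are only two transitive partitions, they are the one without zero-edges and the
totally degenerate one. -/
theorem transitivePartitions_eq (hE : T.transitivePartitions.ncard = 2) :
    T.transitivePartitions = {∅, totallyDegenerate S} ∧ ∅ ≠ totallyDegenerate S := by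
  have hne : (∅ : Set (S × Fin 4 × Fin 4)) ≠ totallyDegenerate S := by
    intro h
    obtain ⟨Z, Z', hZ, hE⟩ := Set.ncard_eq_two.mp hE
    refine hZ ?_
    have all : ∀ W ∈ T.transitivePartitions, W = ∅ := by
      intro W hW
      rw [Set.eq_empty_iff_forall_notMem]
      rintro ⟨k, i, j⟩ hx
      have : (k, i, j) ∈ totallyDegenerate S := hW.ne k i j hx
      rwa [← h] at this
    rw [all Z (by simp [hE]), all Z' (by simp [hE])]
  refine ⟨?_, hne⟩
  have hsub : ({∅, totallyDegenerate S} : Set (Set (S × Fin 4 × Fin 4))) ⊆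
      T.transitivePartitions := by
    rintro Z (rfl | rfl)
    · exact isTransitivePartition_empty T
    · exact isTransitivePartition_totallyDegenerate T
  refine (Set.eq_of_subset_of_ncard_le hsub ?_ (Set.finite_of_ncard_ne_zero (by omega))).symm
  rw [hE, Set.ncard_pair hne]

theorem exists_isDegFace_of_descent {P Q : Marked.WithPartition S} (h : Marked.Descent P Q) :
    ∃ n f, IsDegFace P.2 n f := by
  cases h with
  | wild M Z a f hne Z' ha hb hZ' hext => exact ⟨a, f, fun _ _ hij _ _ => ha _ _ hij⟩
  | moderate M Z a f hne Z' hs ha hZ' hext => exact ⟨a, f, ha⟩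

theorem not_isDegFace_empty (k : S) (f : Fin 4) : ¬ IsDegFace ∅ k f := by
  obtain ⟨i, j, hi, hj, hij⟩ : ∃ i j : Fin 4, i ≠ f ∧ j ≠ f ∧ i ≠ j := by
    revert f; decide
  exact fun h => h i j hij hi hj

/-- The variety of the partition without zero-edges is the image of the standard one. -/
theorem partitionVariety_empty (t : S → Fin 4 → Fin 4 → ℂ) :
    T.partitionVariety t ∅ =
      T.virtualImage t (T.ptolemyWith fun k f i j => t k i f * t k j f) := by
  ext X
  constructor
  · rintro ⟨hX, P, hP, -, c, hc, hXc⟩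
    have : P = ⟨T.marked t, (∅ : Set (S × Fin 4 × Fin 4))⟩ := by
      rcases hP.cases_head with h | ⟨Q, hQ, -⟩
      · exact h.symm
      · obtain ⟨n, f, h⟩ := exists_isDegFace_of_descent hQ
        exact (not_isDegFace_empty n f h).elim
    subst this
    exact ⟨hX, c, ⟨hc.isPtolemy, fun k i j hij h => (hc.type k i j hij).mp h⟩, hXc⟩
  · rintro ⟨hX, c, hc, hXc⟩
    refine ⟨hX, ⟨T.marked t, (∅ : Set (S × Fin 4 × Fin 4))⟩, .refl, not_isDegFace_empty, c, ?_, hXc⟩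
    exact ⟨hc.1, fun k i j hij => ⟨fun h => hc.2 k i j hij h, fun h => h.elim⟩, fun _ h => h.elim⟩

theorem invariantWith_eq (hE : T.transitivePartitions.ncard = 2) (t : S → Fin 4 → Fin 4 → ℂ) :
    T.invariantWith t =
      T.virtualImage t (T.ptolemyWith fun k f i j => t k i f * t k j f) := by
  obtain ⟨h1, h2⟩ := transitivePartitions_eq hE
  have : T.transitivePartitions \ {totallyDegenerate S} = {∅} := by
    rw [h1]
    ext Z
    simp only [Set.mem_sdiff, Set.mem_insert_iff, Set.mem_singleton_iff]
    constructor
    · rintro ⟨h | h, h'⟩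
      exacts [h, (h' h).elim]
    · rintro rfl
      exact ⟨Or.inl rfl, h2⟩
  rw [invariantWith, this, Set.biUnion_singleton, partitionVariety_empty]

/-- The edges with vanishing Ptolemy coordinate form a transitive partition. If there are only two
of these, all or none of the coordinates vanish. -/
theorem IsDecoration.mem_ptolemyWith_or (hE : T.transitivePartitions.ncard = 2)
    {t : S → Fin 4 → Fin 4 → ℂ} {v : S → Fin 4 → Fin 2 → ℂ}
    {A : S → Fin 4 → Matrix (Fin 2) (Fin 2) ℂ} (h : T.IsDecoration t v A)
    (ht : ∀ k i f, t k i f ≠ 0) (hv : ∀ k i, v k i ≠ 0) :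
    (wedgeCoords v ∈ T.ptolemyWith fun k f i j => t k i f * t k j f) ∨
      ∀ k i j, wedgeCoords v k i j = 0 := by
  have hP := h.isPtolemy
  have hZ : {e : S × Fin 4 × Fin 4 | e.2.1 ≠ e.2.2 ∧ wedgeCoords v e.1 e.2.1 e.2.2 = 0} ∈
      T.transitivePartitions := by
    constructor
    · exact fun k i j h => h.1
    · exact fun k i j h => ⟨h.1.symm, by rw [hP.orient k i j, h.2, neg_zero]⟩
    · intro k f i j hi hj
      simp only [Set.mem_ofPred_eq]
      rw [hP.ident k f i j hi hj, (T.glue k f).injective.ne_iff, mul_eq_zero,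
        or_iff_right (mul_ne_zero (ht _ _ _) (ht _ _ _))]
    · exact fun k i j l hil h1 h2 => ⟨hil, wedge_eq_zero_trans (hv k j) h1.2 h2.2⟩
  rw [(transitivePartitions_eq hE).1] at hZ
  rcases hZ with hZ | hZ
  · left
    refine ⟨hP, fun k i j hij h0 => ?_⟩
    have : (k, i, j) ∈ (∅ : Set (S × Fin 4 × Fin 4)) := hZ ▸ ⟨hij, h0⟩
    exact this
  · right
    intro k i j
    by_cases hij : i = j
    · rw [hij]; exact wedge_self _
    · have : (k, i, j) ∈ totallyDegenerate S := hij
      rw [← hZ] at this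
      exact this.2

/-! ### Irreducible representations given by decorations -/

/-- The monoid of the scalars `1` and `-1`. -/
def signs : Submonoid ℂ where
  carrier := {z | z ^ 2 = 1}
  one_mem' := one_pow 2
  mul_mem' {a b} ha hb := by
    change (a * b) ^ 2 = 1
    rw [mul_pow, show a ^ 2 = 1 from ha, show b ^ 2 = 1 from hb, one_mul]

/-- Matrices that differ by a sign are equal in `PSL(2, ℂ)`. -/
theorem mk_eq_mk_of_eq_smul {X Y : SL2} {u : ℂ} (hu : u ∈ signs) (h : X.1 = u • Y.1) :
    (QuotientGroup.mk X : PSL2) = QuotientGroup.mk Y := by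
  have hu' : u ^ 2 = 1 := hu
  rw [QuotientGroup.eq, Matrix.SpecialLinearGroup.mem_center_iff]
  refine ⟨u, by simpa using hu', ?_⟩
  have h2 : Y.1 = u • X.1 := by rw [h, smul_smul, ← sq, hu', one_smul]
  have h3 : (X⁻¹ * X : SL2).1 = 1 := by rw [inv_mul_cancel]; rfl
  change _ = X⁻¹.1 * Y.1
  rw [h2, Matrix.mul_smul]
  change _ = u • (X⁻¹ * X : SL2).1
  rw [h3, Matrix.scalar_apply, Matrix.smul_one_eq_diagonal]

theorem frame_smul (v w : Fin 2 → ℂ) {a b : ℂ} (ha : a ∈ signs) (hb : b ≠ 0) :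
    frame (a • v) (b • w) = a • frame v w := by
  have ha' : a * a = 1 := by rw [← sq]; exact ha
  have ha0 : a ≠ 0 := left_ne_zero_of_mul_eq_one ha'
  rw [← frame_mul_matD v w ha0 hb, matD, ← eq_inv_of_mul_eq_one_left ha']
  ext r s
  fin_cases r <;> fin_cases s <;> simp [Matrix.mul_apply, Fin.sum_univ_two, mul_comm]

section Detection

variable {t : S → Fin 4 → Fin 4 → ℂ} {v : S → Fin 4 → Fin 2 → ℂ}
  {A : S → Fin 4 → Matrix (Fin 2) (Fin 2) ℂ}

/-- The development of a decoration along a path, as an element of `SL(2, ℂ)`. -/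
def IsDecoration.devSL (h : T.IsDecoration t v A) (k : S) (w : List (Fin 4)) : SL2 :=
  ⟨T.dev A k w, h.det_dev k w⟩

/-- If all Ptolemy coordinates vanish, the vectors of a decoration, transported along paths, all
lie on the same line. -/
theorem IsDecoration.wedge_dev_eq_zero (h : T.IsDecoration t v A) (ht : ∀ k i f, t k i f ≠ 0)
    (hv : ∀ k i, v k i ≠ 0) (h0 : ∀ k i j, wedgeCoords v k i j = 0) (k : S) (w : List (Fin 4))
    (i j : Fin 4) : wedge (T.dev A k w *ᵥ v (T.endpt k w) i) (v k j) = 0 := by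
  induction w generalizing k j with
  | nil => rw [dev, Matrix.one_mulVec]; exact h0 k i j
  | cons f w ih =>
    obtain ⟨m, hm⟩ := exists_ne f
    have e := wedge_mulVec (A k f) (T.dev A (T.adj k f) w *ᵥ v (T.endpt (T.adj k f) w) i)
      (v (T.adj k f) (T.glue k f m))
    rw [ih, mul_zero, h.mulVec_eq k f m hm.symm, wedge_smul_right, mul_eq_zero,
      or_iff_right (ht _ _ _), Matrix.mulVec_mulVec] at e
    exact wedge_eq_zero_trans (hv k m) e (h0 k m j)

/-- If all Ptolemy coordinates vanish, the developments along closed paths have a common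
invariant line. -/
theorem IsDecoration.exists_fixed_line (h : T.IsDecoration t v A) (ht : ∀ k i f, t k i f ≠ 0)
    (hv : ∀ k i, v k i ≠ 0) (h0 : ∀ k i j, wedgeCoords v k i j = 0) (k : S) :
    ∃ x : ℙ ℂ (Fin 2 → ℂ), ∀ a : T.Loop k, h.devSL k a.1 • x = x := by
  refine ⟨Projectivization.mk ℂ (v k 0) (hv k 0), fun a => ?_⟩
  rw [Projectivization.smul_mk, Projectivization.mk_eq_mk_iff']
  have e := h.wedge_dev_eq_zero ht hv h0 k a.1 0 0
  rw [a.2] at e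
  obtain ⟨z, hz⟩ := exists_eq_smul_of_wedge_eq_zero (hv k 0) e
  exact ⟨z, hz.symm⟩

/-- A product of labels of the natural cocycle along a closed path is conjugate to the
development of the decoration. -/
theorem IsDecoration.devSL_mul_frame {t' : S → Fin 4 → Fin 4 → ℂ} (h : T.IsDecoration t v A)
    (ht : ∀ k i f, t k i f ≠ 0) (hne : ∀ k i j, i ≠ j → wedgeCoords v k i j ≠ 0) {k : S}
    {w : List (Fin 4)} {B : Matrix (Fin 2) (Fin 2) ℂ}
    (hB : Trace (T.marked t') (naturalCocycle t (wedgeCoords v)) (fun _ i j => i ≠ j)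
      (k, 0, 1) (k, 0, 1) w B) :
    frame (v k 0) (v k 1) * B = T.dev A k w * frame (v k 0) (v k 1) :=
  (h.natural_trace ht hne hB).2.2

theorem IsDecoration.exists_frameSL (hne : ∀ k i j, i ≠ j → wedgeCoords v k i j ≠ 0) (k : S) :
    ∃ F : SL2, F.1 = frame (v k 0) (v k 1) :=
  ⟨⟨_, det_frame (hne k 0 1 (by decide))⟩, rfl⟩

theorem loop_ind {k : S} {P : T.Pi1 k → Prop} (h : ∀ a : T.Loop k, P a.cls) (γ : T.Pi1 k) : P γ :=
  Quotient.inductionOn γ h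

/-- An irreducible representation in `SL(2, ℂ)` given by a decoration is detected by the
(enhanced) Ptolemy variety. -/
theorem IsDecoration.isHolonomy (hE : T.transitivePartitions.ncard = 2)
    (h : T.IsDecoration t v A) (ht : ∀ k i f, t k i f ≠ 0) (hv : ∀ k i, v k i ≠ 0) {k : S}
    {ρ : T.Pi1 k →* SL2} (hρ : IsIrreducible ρ) (hD : ∀ a : T.Loop k, ρ a.cls = h.devSL k a.1) :
    (wedgeCoords v ∈ T.ptolemyWith fun k f i j => t k i f * t k j f) ∧
      T.IsHolonomy (naturalCocycle t (wedgeCoords v)) ρ := by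
  rcases h.mem_ptolemyWith_or hE ht hv with hmem | h0
  · refine ⟨hmem, ?_⟩
    obtain ⟨F, hF⟩ := exists_frameSL hmem.2 k
    refine ⟨F, fun a => ⟨?_, fun B hB => ?_⟩⟩
    · have := exists_trace (T := T) (t := 1) (L := naturalCocycle t (wedgeCoords v))
        (ok := fun _ i j => i ≠ j) (k := k) (fun _ _ _ h => h) zero_ne_one a.1 zero_ne_one
      rwa [a.2] at this
    · rw [hF, h.devSL_mul_frame ht hmem.2 hB, ← hF, hD, Matrix.mul_assoc]
      change _ = _ * (F * F⁻¹ : SL2).1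
      rw [mul_inv_cancel]
      simp [devSL]
  · refine (hρ ?_).elim
    obtain ⟨x, hx⟩ := h.exists_fixed_line ht hv h0 k
    refine ⟨x, loop_ind fun a => ?_⟩
    rw [hD, hx]

/-- An irreducible representation in `PSL(2, ℂ)` given by a decoration is detected by the
Ptolemy variety. The signs of the face pairings do not matter in `PSL(2, ℂ)`. -/
theorem IsDecoration.isPSLHolonomy (hE : T.transitivePartitions.ncard = 2)
    (h : T.IsDecoration t v A) (ht : ∀ k i f, t k i f ∈ signs) (hv : ∀ k i, v k i ≠ 0) {k : S}
    {ρ : T.Pi1 k →* PSL2} (hρ : IsIrreducible ρ) (C : PSL2)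
    (hD : ∀ a : T.Loop k, ρ a.cls = C * QuotientGroup.mk (h.devSL k a.1) * C⁻¹) :
    (wedgeCoords v ∈ T.ptolemyWith fun k f i j => t k i f * t k j f) ∧
      T.IsPSLHolonomy (naturalCocycle (fun _ _ _ => 1) (wedgeCoords v)) ρ := by
  have ht2 : ∀ k i f, t k i f * t k i f = 1 := fun k i f => by rw [← sq]; exact ht k i f
  have ht0 : ∀ k i f, t k i f ≠ 0 := fun k i f => left_ne_zero_of_mul_eq_one (ht2 k i f)
  rcases h.mem_ptolemyWith_or hE ht0 hv with hmem | h0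
  · refine ⟨hmem, ?_⟩
    obtain ⟨F, hF⟩ := exists_frameSL hmem.2 k
    refine ⟨C * QuotientGroup.mk F, fun a => ⟨?_, fun B hB => ?_⟩⟩
    · have := exists_trace (T := T) (t := 1)
        (L := naturalCocycle (fun _ _ _ => 1) (wedgeCoords v))
        (ok := fun _ i j => i ≠ j) (k := k) (fun _ _ _ h => h) zero_ne_one a.1 zero_ne_one
      rwa [a.2] at this
    · have hw : ∀ k i j, i ≠ j → wedge (v k i) (v k j) ≠ 0 := hmem.2
      obtain ⟨-, -, u, hu, e⟩ := trace_eq_dev (T := T) (A := A)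
        (G := fun k i j => frame (v k i) (v k j)) signs
        (fun n i j h1 _ => ⟨1, Submonoid.one_mem _, by
          rw [one_smul]; exact frame_mul_matQ (hw _ _ _ h1)⟩)
        (fun n i j l h1 h2 => ⟨1, Submonoid.one_mem _, by
          rw [one_smul]; exact frame_mul_matX (hw _ _ _ h1) (hw _ _ _ h2)⟩)
        (fun n f i j h1 hi hj => ⟨t n i f, ht n i f, by
          rw [mul_frame (h.det_eq_one _ _), h.mulVec_eq _ _ _ hi, h.mulVec_eq _ _ _ hj,
            frame_smul _ _ (ht _ _ _) (ht0 _ _ _), smul_smul, ht2, one_smul]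
          exact (frame_mul_matD _ _ one_ne_zero one_ne_zero).trans (by rw [one_smul, one_smul])⟩)
        hB
      dsimp only at e
      rw [← hF] at e
      have hdet : (u • (F⁻¹ * h.devSL k a.1 * F : SL2).1).det = 1 := by
        rw [Matrix.det_smul, Matrix.SpecialLinearGroup.det_coe, mul_one, Fintype.card_fin]
        exact hu
      have hB' : B = u • (F⁻¹ * h.devSL k a.1 * F : SL2).1 := by
        have h1 : (F⁻¹ * F : SL2).1 * B = B := by
          rw [inv_mul_cancel]; exact Matrix.one_mul B
        rw [← h1]
        change (F⁻¹.1 * F.1) * B = u • (F⁻¹.1 * T.dev A k a.1 * F.1)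
        rw [Matrix.mul_assoc, e, Matrix.mul_smul, Matrix.mul_assoc]
      refine ⟨⟨_, hdet⟩, hB'.symm, ?_⟩
      rw [mk_eq_mk_of_eq_smul (X := ⟨_, hdet⟩) hu rfl, hD]
      simp only [QuotientGroup.mk_mul, QuotientGroup.mk_inv]
      group
  · refine (hρ ?_).elim
    obtain ⟨x, hx⟩ := h.exists_fixed_line ht0 hv h0 k
    refine ⟨C • x, loop_ind fun a => ?_⟩
    rw [hD, mul_smul, mul_smul, inv_smul_smul, Matrix.ProjectiveSpecialLinearGroup.smul_proj_mk,
      hx]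

end Detection

/-! ### Decorations from lifted cocycles -/

variable {σ : S → Fin 4 → ℤˣ} {η : S → Fin 4 → Fin 4 → ℤˣ}

theorem intCast_units_mem_signs (e : ℤˣ) : ((e : ℤ) : ℂ) ∈ signs := by
  rcases Int.units_eq_one_or e with rfl | rfl
  · change (((1 : ℤˣ) : ℤ) : ℂ) ^ 2 = 1
    norm_num
  · change (((-1 : ℤˣ) : ℤ) : ℂ) ^ 2 = 1
    norm_num

theorem intCast_units_mul_self (e : ℤˣ) : ((e : ℤ) : ℂ) * ((e : ℤ) : ℂ) = 1 := by
  rw [← sq]; exact intCast_units_mem_signs e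

theorem sigmaSign_adj (η : S → Fin 4 → Fin 4 → ℤˣ) (k : S) (i f : Fin 4) :
    T.sigmaSign η (T.adj k f) (T.glue k f i) (T.glue k f f) = T.sigmaSign η k i f := by
  unfold sigmaSign
  symm
  refine Finset.prod_equiv (T.glue k f) ?_ ?_
  · intro j
    simp
  · intro j _
    rw [T.adj_adj, T.glue_glue]
    simp [mul_comm]

theorem isCrossingFactor_sigmaSign (T : Tri S) (η : S → Fin 4 → Fin 4 → ℤˣ) :
    T.IsCrossingFactor fun k i f => (T.sigmaSign η k i f : ℤ) where
  ne_zero k i f := left_ne_zero_of_mul_eq_one (intCast_units_mul_self _)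
  back k i f _ := by rw [sigmaSign_adj, intCast_units_mul_self]
  loop x := signs.prod_mem fun _ _ => intCast_units_mem_signs _

theorem sigmaPtolemy_eq (hσ : T.IsCocycle σ) (hη : IsPrimitive σ η) :
    T.sigmaPtolemy η = T.ptolemyWith fun k f i j =>
      ((T.sigmaSign η k i f : ℤ) : ℂ) * ((T.sigmaSign η k j f : ℤ) : ℂ) := by
  have key : ∀ k f i j, f ≠ i → f ≠ j → i ≠ j →
      (((η k i j * η (T.adj k f) (T.glue k f i) (T.glue k f j) : ℤˣ) : ℤ) : ℂ) =
        ((T.sigmaSign η k i f : ℤ) : ℂ) * ((T.sigmaSign η k j f : ℤ) : ℂ) := by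
    intro k f i j hi hj hij
    rw [← T.sigmaSign_mul hσ hη k f i j hi hj hij]
    push_cast
    rfl
  ext c
  constructor
  all_goals
    rintro ⟨hP, hne⟩
    refine ⟨⟨hP.orient, fun k f i j hi hj => ?_, hP.ptolemy⟩, hne⟩
    by_cases hij : i = j
    · rw [hij, hP.apply_self, hP.apply_self, mul_zero]
    · have e := hP.ident k f i j hi hj
      have e' := key k f i j hi hj hij
      exact e.trans (by rw [e'])

theorem mul_matX_apply_zero (M : Matrix (Fin 2) (Fin 2) ℂ) (z : ℂ) (r : Fin 2) :
    (M * matX z) r 0 = M r 0 := by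
  simp [matX, Matrix.mul_apply, Fin.sum_univ_two]

theorem det_matX (z : ℂ) : (matX z).det = 1 := by simp [matX, Matrix.det_fin_two_of]

theorem matX_eq_one_of_mul_self {z : ℂ} (h : matX z * matX z = matX z) : matX z = 1 := by
  have hu : IsUnit (matX z).det := by rw [det_matX]; exact isUnit_one
  exact (Matrix.isUnit_iff_isUnit_det _ |>.mpr hu).mul_eq_left.mp h

/-- Multiplying the long edges of a lifted cocycle by `η` gives a cocycle on each single truncated
simplex, which is therefore the coboundary of a family of frames. -/
theorem IsLiftedCocycle.exists_frames {L : Labeling S} (hL : T.IsLiftedCocycle σ L)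
    (hη : IsPrimitive σ η) (k : S) :
    ∃ G : Fin 4 → Fin 4 → Matrix (Fin 2) (Fin 2) ℂ, (∀ i j, i ≠ j → (G i j).det = 1) ∧
      (∀ i j, i ≠ j → G i j * (((η k i j : ℤ) : ℂ) • L.long k i j) = G j i) ∧
      ∀ i j l, j ≠ i → l ≠ i → G i j * L.short k i j l = G i l := by
  set Q : Fin 4 → Fin 4 → Matrix (Fin 2) (Fin 2) ℂ := fun i j =>
    ((η k i j : ℤ) : ℂ) • L.long k i j with hQ
  set X : Fin 4 → Fin 4 → Fin 4 → Matrix (Fin 2) (Fin 2) ℂ := L.short k with hX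
  have hXdet : ∀ i j l, j ≠ i → l ≠ i → (X i j l).det = 1 := by
    intro i j l hj hl
    obtain ⟨z, hz⟩ := hL.short_mem k i j l hj hl
    rw [hX, hz, det_matX]
  have hX1 : ∀ i j, j ≠ i → X i j j = 1 := by
    intro i j hj
    obtain ⟨z, hz⟩ := hL.short_mem k i j j hj hj
    have := hL.triangle k i j j j hj hj hj
    rw [hz] at this
    rw [hX, hz, matX_eq_one_of_mul_self this]
  have hXX : ∀ i j l m, j ≠ i → l ≠ i → m ≠ i → X i j l * X i l m = X i j m := hL.triangle k
  have hQdet : ∀ i j, i ≠ j → (Q i j).det = 1 := by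
    intro i j hij
    rw [hQ, Matrix.det_smul, hL.det_long k i j hij, mul_one, Fintype.card_fin]
    exact intCast_units_mem_signs _
  have hQQ : ∀ i j, i ≠ j → Q i j * Q j i = 1 := by
    intro i j hij
    simp only [hQ]
    rw [Matrix.smul_mul, Matrix.mul_smul, hL.long_inv k i j hij, smul_smul, hη.symm k i j,
      intCast_units_mul_self, one_smul]
  have hex : ∀ i j l, i ≠ j → j ≠ l → i ≠ l →
      Q i j * X j i l * Q j l * X l j i * Q l i * X i l j = 1 := by
    intro i j l hij hjl hil
    obtain ⟨f, hf⟩ : ∃ f : Fin 4, [f, i, j, l].Nodup := by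
      clear hη hL hQ hX hXdet hX1 hXX hQdet hQQ Q X
      revert i j l; decide
    have e := hL.hexagon k f i j l hf
    have e' := hη.cobdry k f i j l hf
    simp only [hQ, Matrix.smul_mul, Matrix.mul_smul, smul_smul]
    change _ • (L.long k i j * L.short k j i l * L.long k j l * L.short k l j i * L.long k l i *
      L.short k i l j) = _
    rw [e, ← Int.cast_smul_eq_zsmul ℂ, smul_smul, ← e']
    push_cast
    have a := intCast_units_mul_self (η k i j)
    have b := intCast_units_mul_self (η k j l)
    have c := intCast_units_mul_self (η k l i)
    generalize ((η k i j : ℤ) : ℂ) = a' at *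
    generalize ((η k j l : ℤ) : ℂ) = b' at *
    generalize ((η k l i : ℤ) : ℂ) = c' at *
    have : c' * b' * a' * (a' * b' * c') = 1 := by
      linear_combination a * (b' * b') * (c' * c') + b * (c' * c') + c
    convert one_smul ℂ (1 : Matrix (Fin 2) (Fin 2) ℂ) using 2
    rw [← this]
    ring
  -- The hexagon relation, solved for the label of the long edge `jl`.
  have hmove : ∀ j l, j ≠ 0 → l ≠ 0 → j ≠ l →
      Q 0 j * X j 0 l * Q j l = X 0 j l * Q 0 l * X l 0 j := by
    intro j l hj hl hjl
    have e := hex 0 j l hj.symm hjl hl.symm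
    have e1 := hXX l j 0 j hjl hl.symm hjl
    have e2 := hXX 0 l j l hl hj hl
    rw [hX1 l j hjl] at e1
    rw [hX1 0 l hl] at e2
    calc Q 0 j * X j 0 l * Q j l
        = Q 0 j * X j 0 l * Q j l * (X l j 0 * (Q l 0 * (X 0 l j * X 0 j l) * Q 0 l) * X l 0 j) := by
          rw [e2, Matrix.mul_one, hQQ l 0 hl, Matrix.mul_one, e1, Matrix.mul_one]
      _ = (Q 0 j * X j 0 l * Q j l * X l j 0 * Q l 0 * X 0 l j) * (X 0 j l * Q 0 l * X l 0 j) := by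
          simp only [Matrix.mul_assoc]
      _ = _ := by rw [e, Matrix.one_mul]
  -- The frames at the vertex `i` start with the one on the edge towards `0`, or `01` for `i = 0`.
  set b : Fin 4 → Fin 4 := fun i => if i = 0 then 1 else 0 with hb
  have hbi : ∀ i, b i ≠ i := by decide
  set P : Fin 4 → Matrix (Fin 2) (Fin 2) ℂ := fun i => if i = 0 then 1 else X 0 1 i * Q 0 i with hP
  have hPdet : ∀ i, (P i).det = 1 := by
    intro i
    by_cases hi : i = 0
    · simp [hP, hi]
    · simp only [hP, if_neg hi]
      rw [Matrix.det_mul, hXdet 0 1 i one_ne_zero hi, hQdet 0 i (Ne.symm hi), one_mul]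
  refine ⟨fun i j => P i * X i (b i) j, ?_, ?_, ?_⟩
  · intro i j hij
    rw [Matrix.det_mul, hPdet, hXdet i _ j (hbi i) hij.symm, one_mul]
  · have h0 : ∀ j, j ≠ 0 → P 0 * X 0 (b 0) j * Q 0 j = P j * X j (b j) 0 := by
      intro j hj
      simp only [hP, hb, if_neg hj, if_true, Matrix.one_mul]
      rw [hX1 j 0 hj.symm, Matrix.mul_one]
    intro i j hij
    change P i * X i (b i) j * Q i j = P j * X j (b j) i
    by_cases hi : i = 0
    · subst hi
      exact h0 j hij.symm
    by_cases hj : j = 0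
    · subst hj
      rw [← h0 i hi, Matrix.mul_assoc, hQQ 0 i (Ne.symm hi), Matrix.mul_one]
    simp only [hP, hb, if_neg hi, if_neg hj]
    have e := hmove i j hi hj hij
    rw [Matrix.mul_assoc (X 0 1 i), Matrix.mul_assoc (X 0 1 i), e, ← Matrix.mul_assoc,
      ← Matrix.mul_assoc, hXX 0 1 i j one_ne_zero hi hj]
  · intro i j l hj hl
    rw [Matrix.mul_assoc]
    exact congrArg (P i * ·) (hXX i (b i) j l (hbi i) hj hl)

/-- A lifted cocycle with obstruction cocycle `σ` gives a decoration, with the signs of the face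
pairings determined by `η`, and its representation is the one given by the decoration. -/
theorem IsLiftedCocycle.exists_isDecoration {L : Labeling S} (hL : T.IsLiftedCocycle σ L)
    (hσ : T.IsCocycle σ) (hη : IsPrimitive σ η) :
    ∃ v A, ∃ h : T.IsDecoration (fun k i f => (T.sigmaSign η k i f : ℤ)) v A,
      (∀ k i, v k i ≠ 0) ∧ ∀ (k : S) (ρ : T.Pi1 k →* PSL2), T.IsPSLHolonomy L ρ →
        ∃ C : PSL2, ∀ a : T.Loop k, ρ a.cls = C * QuotientGroup.mk (h.devSL k a.1) * C⁻¹ := by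
  choose G hdet hlong hshort using fun k => hL.exists_frames hη k
  set t : S → Fin 4 → Fin 4 → ℂ := fun k i f => (T.sigmaSign η k i f : ℤ) with ht
  have htt : ∀ k i f, t k i f * t k i f = 1 := fun k i f => intCast_units_mul_self _
  have hηη : ∀ k i j, ((η k i j : ℤ) : ℂ) * ((η k i j : ℤ) : ℂ) = 1 := fun k i j =>
    intCast_units_mul_self _
  have hmul : ∀ k f i j, f ≠ i → f ≠ j → i ≠ j →
      t k i f * t k j f = ((η k i j : ℤ) : ℂ) *
        ((η (T.adj k f) (T.glue k f i) (T.glue k f j) : ℤ) : ℂ) := by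
    intro k f i j hi hj hij
    have e := T.sigmaSign_mul hσ hη k f i j hi hj hij
    have e' := congrArg (fun x : ℤˣ => ((x : ℤ) : ℂ)) e
    push_cast at e'
    exact e'
  -- The frames of two adjacent simplices on the common face differ by a matrix, up to signs.
  have hA : ∀ k f, ∃ A : Matrix (Fin 2) (Fin 2) ℂ, A.det = 1 ∧ ∀ i j, f ≠ i → f ≠ j → i ≠ j →
      A * G (T.adj k f) (T.glue k f i) (T.glue k f j) = t k i f • G k i j := by
    intro k f
    have hinj : ∀ {i j}, i ≠ j → T.glue k f i ≠ T.glue k f j := fun h e =>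
      h ((T.glue k f).injective e)
    obtain ⟨i, j, hi, hj, hij⟩ : ∃ i j : Fin 4, f ≠ i ∧ f ≠ j ∧ i ≠ j := by
      clear hinj
      revert f; decide
    have hG' := hdet (T.adj k f) _ _ (hinj hij)
    have hGu : IsUnit (G (T.adj k f) (T.glue k f i) (T.glue k f j)).det := by
      rw [hG']; exact isUnit_one
    set A := t k i f • G k i j * (G (T.adj k f) (T.glue k f i) (T.glue k f j))⁻¹ with hA
    have hAdet : A.det = 1 := by
      rw [hA, Matrix.det_mul, Matrix.det_smul, hdet k i j hij, Matrix.det_nonsing_inv, hG',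
        Fintype.card_fin, sq, htt]
      simp
    have h1 : A * G (T.adj k f) (T.glue k f i) (T.glue k f j) = t k i f • G k i j := by
      rw [hA, Matrix.mul_assoc, Matrix.nonsing_inv_mul _ hGu, Matrix.mul_one]
    have step : ∀ a b c, f ≠ a → f ≠ b → f ≠ c → a ≠ b → a ≠ c →
        A * G (T.adj k f) (T.glue k f a) (T.glue k f b) = t k a f • G k a b →
        A * G (T.adj k f) (T.glue k f a) (T.glue k f c) = t k a f • G k a c := by
      intro a b c ha hb hc hab hac h
      rw [← hshort (T.adj k f) (T.glue k f a) (T.glue k f b) (T.glue k f c) (hinj hab).symm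
        (hinj hac).symm, ← Matrix.mul_assoc, h,
        hL.ident_short k f a b c hab.symm hac.symm ha hb hc, Matrix.smul_mul,
        hshort k a b c hab.symm hac.symm]
    have flip : ∀ a b, f ≠ a → f ≠ b → a ≠ b →
        A * G (T.adj k f) (T.glue k f a) (T.glue k f b) = t k a f • G k a b →
        A * G (T.adj k f) (T.glue k f b) (T.glue k f a) = t k b f • G k b a := by
      intro a b ha hb hab h
      rw [← hlong (T.adj k f) _ _ (hinj hab), ← Matrix.mul_assoc, h,
        hL.ident_long k f a b hab ha hb, ← hlong k a b hab, Matrix.smul_mul, Matrix.mul_smul,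
        Matrix.mul_smul, smul_smul, smul_smul]
      congr 1
      have e := hmul k f a b ha hb hab
      have e1 := hηη k a b
      have e2 := htt k b f
      linear_combination (-(t k a f *
        ((η (T.adj k f) (T.glue k f a) (T.glue k f b) : ℤ) : ℂ))) * e1 +
        (-(t k a f * ((η k a b : ℤ) : ℂ))) * e + ((η k a b : ℤ) : ℂ) * t k b f * htt k a f
    refine ⟨A, hAdet, fun a b ha hb hab => ?_⟩
    by_cases hai : a = i
    · subst hai
      exact step a j b hi hj hb hij hab h1
    · exact step a i b ha hi hb hai hab (flip i a hi ha (Ne.symm hai)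
        (step i j a hi hj ha hij (Ne.symm hai) h1))
  choose A hAdet hAG using hA
  obtain ⟨b, hb⟩ : ∃ b : Fin 4 → Fin 4, ∀ i, i ≠ b i := ⟨fun i => i + 1, by decide⟩
  set v : S → Fin 4 → Fin 2 → ℂ := fun k i r => G k i (b i) r 0 with hv
  have hcol : ∀ k i j, i ≠ j → ∀ r, G k i j r 0 = v k i r := by
    intro k i j hij r
    obtain ⟨z, hz⟩ := hL.short_mem k i (b i) j (hb i).symm hij.symm
    rw [← hshort k i (b i) j (hb i).symm hij.symm, hz, mul_matX_apply_zero]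
  have hdec : T.IsDecoration t v A := by
    refine ⟨hAdet, fun k f i hi => ?_⟩
    obtain ⟨j, hj, hij⟩ : ∃ j : Fin 4, f ≠ j ∧ i ≠ j := by
      clear hi
      revert i f; decide
    ext r
    have e := congrFun (congrFun (hAG k f i j hi hj hij) r) 0
    have hij' : T.glue k f i ≠ T.glue k f j := fun e => hij ((T.glue k f).injective e)
    simp only [Matrix.mul_apply, Matrix.smul_apply, hcol _ _ _ hij, hcol _ _ _ hij'] at e
    exact e
  refine ⟨v, A, hdec, fun k i h0 => ?_, fun k ρ hρ => ?_⟩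
  · have e := hdet k i (b i) (hb i)
    rw [Matrix.det_fin_two, hcol k i _ (hb i), hcol k i _ (hb i), h0] at e
    simp at e
  · obtain ⟨C, hC⟩ := hρ
    obtain ⟨F, hF⟩ : ∃ F : SL2, F.1 = G k 0 1 := ⟨⟨_, hdet k 0 1 zero_ne_one⟩, rfl⟩
    refine ⟨C * (QuotientGroup.mk F)⁻¹, fun a => ?_⟩
    obtain ⟨⟨B, hB⟩, hall⟩ := hC a
    obtain ⟨X, rfl, hX⟩ := hall B hB
    obtain ⟨-, -, u, hu, e⟩ := trace_eq_dev (T := T) (A := A) (G := G) signs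
      (fun n i j h1 _ => ⟨((η n i j : ℤ) : ℂ), intCast_units_mem_signs _, by
        rw [← hlong n i j h1, Matrix.mul_smul, smul_smul, hηη, one_smul]⟩)
      (fun n i j l h1 h2 => ⟨1, Submonoid.one_mem _, by
        rw [one_smul, hshort n i j l (Ne.symm h1) (Ne.symm h2)]⟩)
      (fun n f i j h1 hi hj => ⟨t n i f, intCast_units_mem_signs _, by
        rw [hL.cross_eq, Matrix.mul_one, hAG n f i j hi hj h1, smul_smul, htt, one_smul]⟩) hB
    dsimp only at e
    rw [← hF] at e
    have : (QuotientGroup.mk (F * X) : PSL2) = QuotientGroup.mk (hdec.devSL k a.1 * F) :=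
      mk_eq_mk_of_eq_smul hu e
    simp only [QuotientGroup.mk_mul] at this
    rw [hX, eq_inv_mul_of_mul_eq this]
    group

/-- An irreducible representation with obstruction class `[σ]` is detected by `P^σ(𝒯)`. -/
theorem exists_mem_sigmaPtolemy (hE : T.transitivePartitions.ncard = 2) (hσ : T.IsCocycle σ)
    (hη : IsPrimitive σ η) {k : S} {ρ : T.Pi1 k →* PSL2} (hρ : T.HasObstructionClass σ ρ)
    (hirr : IsIrreducible ρ) :
    ∃ c ∈ T.sigmaPtolemy η, T.IsPSLHolonomy (naturalCocycle (fun _ _ _ => 1) c) ρ := by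
  obtain ⟨L, hL, hhol⟩ := hρ
  obtain ⟨v, A, h, hv, hC⟩ := hL.exists_isDecoration hσ hη
  obtain ⟨C, hC⟩ := hC k ρ hhol
  obtain ⟨h1, h2⟩ := h.isPSLHolonomy hE (fun _ _ _ => intCast_units_mem_signs _) hv hirr C hC
  refine ⟨_, ?_, h2⟩
  rw [sigmaPtolemy_eq hσ hη]
  exact h1

/-! ### Paths in the boundary -/

/-- The cusp of a boundary triangle. -/
def cuspOf (T : Tri S) (y : S × Fin 4) : T.Cusp := Quot.mk _ y

theorem monomial_eq (wt : S → Fin 4 → Fin 4 → ℤ × ℤ) (m l : T.Cusp → ℂ) (k : S) (i f : Fin 4) :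
    T.monomial wt m l k i f =
      m (T.cuspOf (k, i)) ^ (wt k i f).1 * l (T.cuspOf (k, i)) ^ (wt k i f).2 := rfl

theorem Homotopic.endpt_eq {k : S} {w w' : List (Fin 4)} (h : T.Homotopic k w w') :
    T.endpt k w = T.endpt k w' := by
  induction h with
  | refl => rfl
  | symm _ ih => exact ih.symm
  | trans _ _ ih ih' => exact ih.trans ih'
  | back p q f =>
    have : T.endpt (T.endpt k p) [f, T.glue (T.endpt k p) f f] = T.endpt k p := T.adj_adj _ _
    rw [List.append_assoc, endpt_append, endpt_append, endpt_append, this]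
  | loop p q x hx =>
    rw [List.append_assoc, endpt_append, endpt_append, endpt_append, ← hx, endpt_edgeLoop]

theorem linkEnd_append (y : S × Fin 4) (p q : List (Fin 4)) :
    T.linkEnd y (p ++ q) = T.linkEnd (T.linkEnd y p) q := List.foldl_append

theorem isLinkPath_append (y : S × Fin 4) (p q : List (Fin 4)) :
    T.IsLinkPath y (p ++ q) ↔ T.IsLinkPath y p ∧ T.IsLinkPath (T.linkEnd y p) q := by
  induction p generalizing y with
  | nil => simp [IsLinkPath, linkEnd]
  | cons f p ih =>
    rw [List.cons_append, IsLinkPath, ih, IsLinkPath, and_assoc]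
    rfl

theorem linkSum_append (wt : S → Fin 4 → Fin 4 → ℤ × ℤ) (y : S × Fin 4) (p q : List (Fin 4)) :
    T.linkSum wt y (p ++ q) = T.linkSum wt y p + T.linkSum wt (T.linkEnd y p) q := by
  induction p generalizing y with
  | nil => exact (zero_add _).symm
  | cons f p ih =>
    rw [List.cons_append, linkSum, ih, linkSum, add_assoc]
    rfl

theorem linkEnd_fst (y : S × Fin 4) (p : List (Fin 4)) : (T.linkEnd y p).1 = T.endpt y.1 p := by
  induction p generalizing y with
  | nil => rfl
  | cons f p ih => exact ih _

/-- The product of the factors `t` along a path in the boundary. -/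
def linkProd (T : Tri S) (t : S → Fin 4 → Fin 4 → ℂ) : S × Fin 4 → List (Fin 4) → ℂ
  | _, [] => 1
  | y, f :: w => t y.1 y.2 f * linkProd T t (T.adj y.1 f, T.glue y.1 f y.2) w

theorem linkProd_append (t : S → Fin 4 → Fin 4 → ℂ) (y : S × Fin 4) (p q : List (Fin 4)) :
    T.linkProd t y (p ++ q) = T.linkProd t y p * T.linkProd t (T.linkEnd y p) q := by
  induction p generalizing y with
  | nil => exact (one_mul _).symm
  | cons f p ih =>
    rw [List.cons_append, linkProd, ih, linkProd, mul_assoc]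
    rfl

theorem linkProd_ne_zero {t : S → Fin 4 → Fin 4 → ℂ} (ht : ∀ k i f, t k i f ≠ 0) (y : S × Fin 4)
    (p : List (Fin 4)) : T.linkProd t y p ≠ 0 := by
  induction p generalizing y with
  | nil => exact one_ne_zero
  | cons f p ih => exact mul_ne_zero (ht _ _ _) (ih _)

theorem linkProd_one (y : S × Fin 4) (p : List (Fin 4)) :
    T.linkProd (fun _ _ _ => 1) y p = 1 := by
  induction p generalizing y with
  | nil => rfl
  | cons f p ih => exact (one_mul _).trans (ih _)

/-- Two boundary triangles of the same cusp are joined by a path in the boundary. -/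
theorem exists_linkPath {y z : S × Fin 4} (h : T.cuspOf y = T.cuspOf z) :
    ∃ p, T.IsLinkPath y p ∧ T.linkEnd y p = z := by
  have h' := Quot.eqvGen_exact h
  clear h
  suffices (∃ p, T.IsLinkPath y p ∧ T.linkEnd y p = z) ∧
      ∃ p, T.IsLinkPath z p ∧ T.linkEnd z p = y from this.1
  induction h' with
  | rel y z h =>
    obtain ⟨f, hf, rfl⟩ := h
    refine ⟨⟨[f], ⟨hf, trivial⟩, rfl⟩, [T.glue y.1 f f], ⟨?_, trivial⟩, ?_⟩
    · exact fun e => hf ((T.glue y.1 f).injective e)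
    · change (T.adj (T.adj _ _) _, T.glue (T.adj _ _) _ _) = y
      rw [T.adj_adj, T.glue_glue]
      simp
  | refl y => exact ⟨⟨[], trivial, rfl⟩, [], trivial, rfl⟩
  | symm y z _ ih => exact ih.symm
  | trans x y z _ _ ih ih' =>
    obtain ⟨⟨p, hp, rfl⟩, ⟨p', hp', e'⟩⟩ := ih
    obtain ⟨⟨q, hq, rfl⟩, ⟨q', hq', e⟩⟩ := ih'
    refine ⟨⟨p ++ q, (isLinkPath_append _ _ _).mpr ⟨hp, hq⟩, linkEnd_append _ _ _⟩,
      q' ++ p', (isLinkPath_append _ _ _).mpr ⟨hq', by rwa [e]⟩, ?_⟩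
    rw [linkEnd_append, e, e']

theorem rev_isLinkPath {y : S × Fin 4} {p : List (Fin 4)} (hp : T.IsLinkPath y p) :
    T.IsLinkPath (T.linkEnd y p) (T.rev y.1 p) ∧ T.linkEnd (T.linkEnd y p) (T.rev y.1 p) = y := by
  induction p generalizing y with
  | nil => exact ⟨trivial, rfl⟩
  | cons f p ih =>
    obtain ⟨hf, hp⟩ := hp
    obtain ⟨h1, h2⟩ := ih hp
    change T.IsLinkPath (T.linkEnd (T.adj y.1 f, T.glue y.1 f y.2) p)
      (T.rev (T.adj y.1 f) p ++ [T.glue y.1 f f]) ∧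
      T.linkEnd (T.linkEnd (T.adj y.1 f, T.glue y.1 f y.2) p)
        (T.rev (T.adj y.1 f) p ++ [T.glue y.1 f f]) = y
    rw [isLinkPath_append, linkEnd_append, h2]
    refine ⟨⟨h1, fun e => hf ((T.glue y.1 f).injective e), trivial⟩, ?_⟩
    change (T.adj (T.adj _ _) _, T.glue (T.adj _ _) _ _) = y
    rw [T.adj_adj, T.glue_glue]
    simp

theorem IsFraming.linkSum_rev {wt : S → Fin 4 → Fin 4 → ℤ × ℤ} (hwt : T.IsFraming wt)
    {y : S × Fin 4} {p : List (Fin 4)} (hp : T.IsLinkPath y p) :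
    T.linkSum wt (T.linkEnd y p) (T.rev y.1 p) = - T.linkSum wt y p := by
  induction p generalizing y with
  | nil => exact neg_zero.symm
  | cons f p ih =>
    obtain ⟨hf, hp⟩ := hp
    have h1 := ih hp
    have h2 := (rev_isLinkPath hp).2
    change T.linkSum wt (T.linkEnd (T.adj y.1 f, T.glue y.1 f y.2) p)
      (T.rev (T.adj y.1 f) p ++ [T.glue y.1 f f]) = - (wt _ _ _ + _)
    rw [linkSum_append, h1, h2]
    change _ + (wt (T.adj y.1 f) (T.glue y.1 f y.2) (T.glue y.1 f f) + 0) = _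
    rw [hwt.antisymm _ _ _ hf, add_zero, neg_add, add_comm]

theorem LinkHomotopic.homotopic {y : S × Fin 4} {w w' : List (Fin 4)}
    (h : T.LinkHomotopic y w w') : T.Homotopic y.1 w w' := by
  induction h with
  | refl => exact .refl _
  | symm _ ih => exact ih.symm
  | trans _ _ ih ih' => exact ih.trans ih'
  | back p q f _ =>
    rw [linkEnd_fst]
    exact .back p q f
  | loop p q x hx =>
    refine .loop p q x ?_
    rw [← linkEnd_fst, ← hx]

theorem cusp_eq_of_ne {k : S} {i f : Fin 4} (hf : f ≠ i) :
    T.cuspOf (T.adj k f, T.glue k f i) = T.cuspOf (k, i) :=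
  (Quot.sound ⟨f, hf, rfl⟩).symm

section Monomial

variable {wt : S → Fin 4 → Fin 4 → ℤ × ℤ} {m l : T.Cusp → ℂ}

theorem linkProd_monomial (hm : ∀ s, m s ≠ 0) (hl : ∀ s, l s ≠ 0) {y : S × Fin 4}
    {p : List (Fin 4)} (hp : T.IsLinkPath y p) :
    T.linkProd (T.monomial wt m l) y p =
      m (T.cuspOf y) ^ (T.linkSum wt y p).1 * l (T.cuspOf y) ^ (T.linkSum wt y p).2 := by
  induction p generalizing y with
  | nil => simp [linkProd, linkSum]
  | cons f p ih =>
    obtain ⟨hf, hp⟩ := hp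
    rw [linkProd, ih hp, linkSum, monomial_eq, cusp_eq_of_ne hf, Prod.fst_add, Prod.snd_add,
      zpow_add₀ (hm _), zpow_add₀ (hl _)]
    ring

theorem IsFraming.isCrossingFactor_monomial (hwt : T.IsFraming wt) (hm : ∀ s, m s ≠ 0)
    (hl : ∀ s, l s ≠ 0) : T.IsCrossingFactor (T.monomial wt m l) where
  ne_zero k i f := mul_ne_zero (zpow_ne_zero _ (hm _)) (zpow_ne_zero _ (hl _))
  back k i f hif := by
    rw [monomial_eq, monomial_eq, cusp_eq_of_ne hif.symm, hwt.antisymm k i f hif.symm, Prod.fst_neg,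
      Prod.snd_neg, zpow_neg, zpow_neg]
    have h1 := zpow_ne_zero (wt k i f).1 (hm (T.cuspOf (k, i)))
    have h2 := zpow_ne_zero (wt k i f).2 (hl (T.cuspOf (k, i)))
    field_simp
  loop x := by
    have hc : ∀ n, T.cuspOf ((T.rot^[n] x).1, (T.rot^[n] x).2 0) =
        T.cuspOf (x.1, x.2 0) := by
      intro n
      induction n with
      | zero => rfl
      | succ n ih =>
        rw [Function.iterate_succ_apply', rot_snd_of_ne _ (by decide) (by decide), ← ih]
        exact cusp_eq_of_ne fun e => absurd ((T.rot^[n] x).2.injective e) (by decide)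
    have key : ∀ N, (∏ n ∈ Finset.range N,
        T.monomial wt m l (T.rot^[n] x).1 ((T.rot^[n] x).2 0) ((T.rot^[n] x).2 2)) =
        m (T.cuspOf (x.1, x.2 0)) ^ (∑ n ∈ Finset.range N,
          wt (T.rot^[n] x).1 ((T.rot^[n] x).2 0) ((T.rot^[n] x).2 2)).1 *
        l (T.cuspOf (x.1, x.2 0)) ^ (∑ n ∈ Finset.range N,
          wt (T.rot^[n] x).1 ((T.rot^[n] x).2 0) ((T.rot^[n] x).2 2)).2 := by
      intro N
      induction N with
      | zero => simp
      | succ N ih =>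
        rw [Finset.prod_range_succ, Finset.sum_range_succ, ih, monomial_eq, hc, Prod.fst_add,
          Prod.snd_add, zpow_add₀ (hm _), zpow_add₀ (hl _)]
        ring
    rw [key, hwt.closed]
    simp

end Monomial

/-! ### Decorations of representations -/

theorem exists_paths (hconn : T.Connected) (k₀ : S) :
    ∃ u : S → List (Fin 4), (∀ k, T.endpt k₀ (u k) = k) ∧ u k₀ = [] := by
  classical
  choose u hu using hconn k₀
  refine ⟨Function.update u k₀ [], fun k => ?_, Function.update_self ..⟩
  by_cases hk : k = k₀
  · subst hk
    rw [Function.update_self]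
    rfl
  · rw [Function.update_of_ne hk, hu]

section Transport

variable {k₀ : S} (ρ : T.Pi1 k₀ →* SL2) {u : S → List (Fin 4)} (hu : ∀ k, T.endpt k₀ (u k) = k)

/-- The closed path at the base simplex that follows `w` and whose ends are joined to the base by
the chosen paths `u`. -/
def closeUp (hu : ∀ k, T.endpt k₀ (u k) = k) (k : S) (w : List (Fin 4)) : T.Loop k₀ :=
  ⟨u k ++ w ++ T.rev k₀ (u (T.endpt k w)), by
    have := endpt_rev (T := T) k₀ (u (T.endpt k w))
    rw [hu] at this
    rw [endpt_append, endpt_append, hu, this]⟩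

/-- The value of the representation `ρ` on a path, made into a closed path by the chosen paths
`u` to the base simplex. -/
def transport (k : S) (w : List (Fin 4)) : SL2 := ρ (closeUp hu k w).cls

theorem transport_congr {k : S} {w w' : List (Fin 4)} (h : T.Homotopic k w w') :
    transport ρ hu k w = transport ρ hu k w' := by
  refine congrArg ρ (Quotient.sound ?_)
  change T.Homotopic k₀ (u k ++ w ++ T.rev k₀ (u (T.endpt k w)))
    (u k ++ w' ++ T.rev k₀ (u (T.endpt k w')))
  rw [h.endpt_eq]
  refine Homotopic.append_right (Homotopic.append_left _ ?_) _
  rwa [hu]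

theorem transport_nil (k : S) : transport ρ hu k [] = 1 := by
  rw [transport, ← map_one ρ]
  refine congrArg ρ (Quotient.sound ?_)
  change T.Homotopic k₀ (u k ++ [] ++ T.rev k₀ (u k)) []
  rw [List.append_nil]
  exact append_rev k₀ (u k)

theorem transport_append (k : S) (w w' : List (Fin 4)) :
    transport ρ hu k (w ++ w') = transport ρ hu k w * transport ρ hu (T.endpt k w) w' := by
  rw [transport, transport, transport, ← map_mul]
  refine congrArg ρ (Quotient.sound ?_)
  change T.Homotopic k₀ (u k ++ (w ++ w') ++ T.rev k₀ (u (T.endpt k (w ++ w'))))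
    ((u k ++ w ++ T.rev k₀ (u (T.endpt k w))) ++
      (u (T.endpt k w) ++ w' ++ T.rev k₀ (u (T.endpt (T.endpt k w) w'))))
  rw [← endpt_append]
  have h := rev_append (T := T) k₀ (u (T.endpt k w))
  rw [hu] at h
  have h2 := (Homotopic.append_left (T := T) (k := k₀) (u k ++ w)
    (by rw [endpt_append, hu]; exact h)).append_right
      (w' ++ T.rev k₀ (u (T.endpt k (w ++ w'))))
  simp only [List.append_assoc, List.append_nil] at h2 ⊢
  exact h2.symm

theorem transport_rev {k : S} {w : List (Fin 4)} :
    transport ρ hu (T.endpt k w) (T.rev k w) = (transport ρ hu k w)⁻¹ := by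
  rw [eq_inv_iff_mul_eq_one, ← transport_nil ρ hu (T.endpt k w),
    ← transport_congr ρ hu (rev_append k w), transport_append, endpt_rev]

theorem dev_transport (k : S) (w : List (Fin 4)) :
    T.dev (fun k f => (transport ρ hu k [f]).1) k w = (transport ρ hu k w).1 := by
  induction w generalizing k with
  | nil => rw [dev, transport_nil]; rfl
  | cons f w ih =>
    rw [dev, ih]
    exact (congrArg Subtype.val (transport_append ρ hu k [f] w)).symm

theorem transport_base (hu₀ : u k₀ = []) (a : T.Loop k₀) : transport ρ hu k₀ a.1 = ρ a.cls := by
  refine congrArg ρ (congrArg Loop.cls (Subtype.ext ?_))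
  change u k₀ ++ a.1 ++ T.rev k₀ (u (T.endpt k₀ a.1)) = a.1
  rw [a.2, hu₀]
  simp [rev]

/-- Closing up a closed path in the boundary gives an element of a peripheral subgroup. -/
theorem isPeripheral_closeUp {y : S × Fin 4} {q : List (Fin 4)} (hq : T.IsLinkPath y q)
    (hy : T.linkEnd y q = y) : T.IsPeripheral k₀ (u y.1) y.2 (closeUp hu y.1 q) := by
  have e : T.endpt y.1 q = y.1 := by rw [← linkEnd_fst, hy]
  refine ⟨q, ?_, ?_, ?_⟩
  · rwa [hu]
  · rwa [hu]
  · change T.Homotopic k₀ (u y.1 ++ q ++ T.rev k₀ (u (T.endpt y.1 q)) ++ u y.1) (u y.1 ++ q)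
    rw [e]
    have h := rev_append (T := T) k₀ (u y.1)
    rw [hu] at h
    have h2 := Homotopic.append_left (T := T) (k := k₀) (u y.1 ++ q)
      (by rw [endpt_append, hu, e]; exact h)
    simpa only [List.append_assoc, List.append_nil] using h2

/-- Suppose that at one boundary triangle of each cusp there is a common eigenvector of the
peripheral subgroup, with eigenvalues given by the factors `t`. Transporting these eigenvectors
along paths in the boundary gives a decoration. -/
theorem exists_isDecoration_transport {t : S → Fin 4 → Fin 4 → ℂ} (ht : ∀ k i f, t k i f ≠ 0)
    {y : T.Cusp → S × Fin 4} (hy : ∀ s, T.cuspOf (y s) = s) {x : T.Cusp → Fin 2 → ℂ}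
    (hx : ∀ s, x s ≠ 0)
    (hxy : ∀ s q, T.IsLinkPath (y s) q → T.linkEnd (y s) q = y s →
      (transport ρ hu (y s).1 q).1 *ᵥ x s = T.linkProd t (y s) q • x s) :
    ∃ v, T.IsDecoration t v (fun k f => (transport ρ hu k [f]).1) ∧ ∀ k i, v k i ≠ 0 := by
  have hinv : ∀ (X : SL2) (z : Fin 2 → ℂ), X⁻¹.1 *ᵥ (X.1 *ᵥ z) = z := by
    intro X z
    rw [Matrix.mulVec_mulVec]
    change (X⁻¹ * X : SL2).1 *ᵥ z = z
    rw [inv_mul_cancel]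
    exact Matrix.one_mulVec z
  choose r hr hre using fun k i => exists_linkPath (T := T) (y := (k, i)) (hy (T.cuspOf (k, i))).symm
  set v : S → Fin 4 → Fin 2 → ℂ := fun k i =>
    (T.linkProd t (k, i) (r k i))⁻¹ • ((transport ρ hu k (r k i)).1 *ᵥ x (T.cuspOf (k, i))) with hv
  -- The choice of the path to the distinguished boundary triangle does not matter.
  have key : ∀ k i s q, T.IsLinkPath (k, i) q → T.linkEnd (k, i) q = y s →
      s = T.cuspOf (k, i) →
      (transport ρ hu k q).1 *ᵥ x s = T.linkProd t (k, i) q • v k i := by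
    rintro k i s q hq hqe rfl
    obtain ⟨p, hp, hpe⟩ := exists_linkPath (T := T) (hy (T.cuspOf (k, i)))
    have hpk : T.endpt (y (T.cuspOf (k, i))).1 p = k := by rw [← linkEnd_fst, hpe]
    have loop : ∀ q, T.IsLinkPath (k, i) q → T.linkEnd (k, i) q = y (T.cuspOf (k, i)) →
        (transport ρ hu k q).1 *ᵥ x (T.cuspOf (k, i)) = T.linkProd t (k, i) q •
          ((transport ρ hu (y (T.cuspOf (k, i))).1 p)⁻¹.1 *ᵥ
            (T.linkProd t (y (T.cuspOf (k, i))) p • x (T.cuspOf (k, i)))) := by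
      intro q hq hqe
      have e := hxy (T.cuspOf (k, i)) (p ++ q)
        ((isLinkPath_append _ _ _).mpr ⟨hp, by rwa [hpe]⟩) (by rw [linkEnd_append, hpe, hqe])
      rw [transport_append, hpk, linkProd_append, hpe, mul_smul, smul_comm] at e
      rw [← Matrix.mulVec_smul, ← e]
      change _ = _ *ᵥ (((transport ρ hu _ p).1 * (transport ρ hu k q).1) *ᵥ _)
      rw [← Matrix.mulVec_mulVec, hinv]
    rw [loop q hq hqe, hv]
    dsimp only
    rw [loop _ (hr k i) (hre k i), smul_smul, smul_smul,
      mul_assoc, inv_mul_cancel₀ (linkProd_ne_zero ht _ _), mul_one]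
  refine ⟨v, ⟨fun k f => Matrix.SpecialLinearGroup.det_coe _, fun k f i hi => ?_⟩, fun k i h0 => ?_⟩
  · have e := cusp_eq_of_ne (T := T) (k := k) hi
    have e1 := key (T.adj k f) (T.glue k f i) _ _ (hr _ _) (hre _ _) rfl
    have e2 := key k i _ (f :: r (T.adj k f) (T.glue k f i)) ⟨hi, hr _ _⟩ (hre _ _) e
    rw [← List.singleton_append, transport_append] at e2
    change ((transport ρ hu k [f]).1 * (transport ρ hu (T.adj k f) _).1) *ᵥ _ =
      (t k i f * T.linkProd t (T.adj k f, T.glue k f i) _) • _ at e2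
    rw [← Matrix.mulVec_mulVec, e1, Matrix.mulVec_smul, mul_comm, mul_smul] at e2
    exact smul_right_injective _ (linkProd_ne_zero ht _ _) e2
  · have e := key k i _ _ (hr k i) (hre k i) rfl
    rw [h0, smul_zero] at e
    have e' := hinv (transport ρ hu k (r k i)) (x (T.cuspOf (k, i)))
    rw [e, Matrix.mulVec_zero] at e'
    exact hx _ e'.symm

end Transport

/-- An irreducible representation in `SL(2, ℂ)` whose peripheral subgroups have common
eigenvectors with eigenvalues given by the factors `t` is detected by the Ptolemy variety. -/
theorem exists_mem_ptolemyWith (hE : T.transitivePartitions.ncard = 2)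
    {k₀ : S} {ρ : T.Pi1 k₀ →* SL2} (hirr : IsIrreducible ρ) {u : S → List (Fin 4)}
    (hu : ∀ k, T.endpt k₀ (u k) = k) (hu₀ : u k₀ = [])
    {t : S → Fin 4 → Fin 4 → ℂ} (ht : ∀ k i f, t k i f ≠ 0)
    {y : T.Cusp → S × Fin 4} (hy : ∀ s, T.cuspOf (y s) = s) {x : T.Cusp → Fin 2 → ℂ}
    (hx : ∀ s, x s ≠ 0)
    (hxy : ∀ s q, T.IsLinkPath (y s) q → T.linkEnd (y s) q = y s →
      (transport ρ hu (y s).1 q).1 *ᵥ x s = T.linkProd t (y s) q • x s) :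
    ∃ c ∈ T.ptolemyWith fun k f i j => t k i f * t k j f,
      T.IsHolonomy (naturalCocycle t c) ρ := by
  obtain ⟨v, h, hv⟩ := exists_isDecoration_transport ρ hu ht hy hx hxy
  obtain ⟨h1, h2⟩ := h.isHolonomy hE ht hv hirr fun a => by
    rw [← transport_base ρ hu hu₀ a]
    exact Subtype.ext (dev_transport ρ hu k₀ a.1).symm
  exact ⟨_, h1, h2⟩

theorem mulVec_of_mem_borel {g X : SL2} (h : g⁻¹ * X * g ∈ borel) :
    ∃ z : ℂˣ, X.1 *ᵥ (fun r => g.1 r 0) = (z : ℂ) • (fun r => g.1 r 0) ∧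
      z = (g⁻¹ * X * g).1 0 0 := by
  have h10 : (g⁻¹ * X * g).1 1 0 = 0 := h
  have hdet := (g⁻¹ * X * g).2
  rw [Matrix.det_fin_two, h10, mul_zero, sub_zero] at hdet
  have hX : X.1 * g.1 = g.1 * (g⁻¹ * X * g).1 := by
    change (X * g).1 = (g * (g⁻¹ * X * g)).1
    rw [mul_assoc, mul_inv_cancel_left]
  refine ⟨Units.mk0 _ (left_ne_zero_of_mul_eq_one hdet), ?_, rfl⟩
  ext r
  have e := congrFun (congrFun hX r) 0
  rw [Matrix.mul_apply, Matrix.mul_apply, Fin.sum_univ_two, Fin.sum_univ_two, h10, mul_zero,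
    add_zero] at e
  simp only [Matrix.mulVec, dotProduct, Fin.sum_univ_two, Units.val_mk0, Pi.smul_apply,
    smul_eq_mul]
  rw [e, mul_comm]

theorem firstColumn_ne_zero (g : SL2) : (fun r => g.1 r 0) ≠ 0 := by
  intro h
  have hdet := g.2
  rw [Matrix.det_fin_two, show g.1 0 0 = 0 from congrFun h 0, show g.1 1 0 = 0 from congrFun h 1]
    at hdet
  simp at hdet

/-- Every irreducible boundary-unipotent representation is detected by `P(𝒯)`. -/
theorem exists_mem_ptolemy (hconn : T.Connected) (hE : T.transitivePartitions.ncard = 2)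
    {k : S} {ρ : T.Pi1 k →* SL2} (hρ : T.BoundaryIn unipotent ρ) (hirr : IsIrreducible ρ) :
    ∃ c ∈ T.ptolemy, T.IsHolonomy (naturalCocycle (fun _ _ _ => 1) c) ρ := by
  obtain ⟨u, hu, hu₀⟩ := exists_paths hconn k
  choose g hg using hρ
  have hy : ∀ s : T.Cusp, T.cuspOf (Quot.out s) = s := Quot.out_eq
  obtain ⟨c, hc, h⟩ := exists_mem_ptolemyWith hE hirr hu hu₀ (t := fun _ _ _ => 1)
    (fun _ _ _ => one_ne_zero) hy
    (x := fun s r => (g (u (Quot.out s).1) (Quot.out s).2).1 r 0)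
    (fun s => firstColumn_ne_zero _) (fun s q hq hqe => by
      obtain ⟨z, hz⟩ := hg _ _ _ (isPeripheral_closeUp hu hq hqe)
      have hz0 : _ ∈ borel := show _ = (0 : ℂ) by rw [hz]; simp [matX]
      obtain ⟨w, hw, hw'⟩ := mulVec_of_mem_borel hz0
      rw [hz] at hw'
      rw [linkProd_one]
      refine hw.trans ?_
      rw [hw']
      simp [matX])
  refine ⟨c, ?_, h⟩
  rw [ptolemy]
  simpa only [mul_one] using hc

theorem zpow_mulVec {X : SL2} {a : ℂ} (ha : a ≠ 0) {x : Fin 2 → ℂ} (h : X.1 *ᵥ x = a • x)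
    (n : ℤ) : (X ^ n).1 *ᵥ x = a ^ n • x := by
  have hinv : X⁻¹.1 *ᵥ x = a⁻¹ • x := by
    have e := congrArg (fun z => a⁻¹ • (X⁻¹.1 *ᵥ z)) h
    change a⁻¹ • (X⁻¹.1 *ᵥ (X.1 *ᵥ x)) = a⁻¹ • (X⁻¹.1 *ᵥ (a • x)) at e
    rw [Matrix.mulVec_smul, smul_smul, inv_mul_cancel₀ ha, one_smul, Matrix.mulVec_mulVec] at e
    rw [← e]
    change a⁻¹ • ((X⁻¹ * X : SL2).1 *ᵥ x) = _
    rw [inv_mul_cancel]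
    exact congrArg _ (Matrix.one_mulVec x)
  induction n with
  | zero => simp
  | succ n ih =>
    rw [zpow_add_one, zpow_add_one₀ ha, mul_comm, mul_smul, ← ih, ← Matrix.mulVec_smul, ← h,
      Matrix.mulVec_mulVec]
    rfl
  | pred n ih =>
    rw [zpow_sub_one, zpow_sub_one₀ ha, mul_comm, mul_smul, ← ih, ← Matrix.mulVec_smul, ← hinv,
      Matrix.mulVec_mulVec]
    rfl

section Framing

variable {wt : S → Fin 4 → Fin 4 → ℤ × ℤ} {k₀ : S} (ρ : T.Pi1 k₀ →* SL2) {u : S → List (Fin 4)}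
  (hu : ∀ k, T.endpt k₀ (u k) = k)

/-- The values of a representation on the closed paths in the boundary at `y`, together with the
homology classes of these paths. -/
def IsFraming.graph (hwt : T.IsFraming wt) (y : S × Fin 4) :
    Subgroup (SL2 × Multiplicative (ℤ × ℤ)) where
  carrier := {z | ∃ q, T.IsLinkPath y q ∧ T.linkEnd y q = y ∧ transport ρ hu y.1 q = z.1 ∧
    T.linkSum wt y q = z.2.toAdd}
  one_mem' := ⟨[], trivial, rfl, transport_nil ρ hu _, rfl⟩
  mul_mem' := by
    rintro ⟨a, n⟩ ⟨b, n'⟩ ⟨p, hp, hpe, rfl, h⟩ ⟨q, hq, hqe, rfl, h'⟩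
    have e : T.endpt y.1 p = y.1 := by rw [← linkEnd_fst, hpe]
    refine ⟨p ++ q, (isLinkPath_append _ _ _).mpr ⟨hp, by rwa [hpe]⟩,
      by rw [linkEnd_append, hpe, hqe], ?_, ?_⟩
    · rw [transport_append, e]; rfl
    · rw [linkSum_append, hpe, h, h']; rfl
  inv_mem' := by
    rintro ⟨a, n⟩ ⟨p, hp, hpe, rfl, h⟩
    have e : T.endpt y.1 p = y.1 := by rw [← linkEnd_fst, hpe]
    obtain ⟨h1, h2⟩ := rev_isLinkPath hp
    have h3 := hwt.linkSum_rev hp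
    have h4 := transport_rev ρ hu (k := y.1) (w := p)
    rw [hpe] at h1 h2 h3
    rw [e] at h4
    exact ⟨_, h1, h2, h4, by rw [h3, h]; rfl⟩

/-- Since closed paths in the boundary with trivial homology class are null-homotopic, the
representation of a peripheral subgroup is determined by a meridian and a longitude. -/
theorem IsFraming.eq_zpow_mul_zpow (hwt : T.IsFraming wt) {y : S × Fin 4} {q p p' : List (Fin 4)}
    (hq : T.IsLinkPath y q ∧ T.linkEnd y q = y)
    (hp : T.IsLinkPath y p ∧ T.linkEnd y p = y ∧ T.linkSum wt y p = (1, 0))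
    (hp' : T.IsLinkPath y p' ∧ T.linkEnd y p' = y ∧ T.linkSum wt y p' = (0, 1)) :
    transport ρ hu y.1 q = transport ρ hu y.1 p ^ (T.linkSum wt y q).1 *
      transport ρ hu y.1 p' ^ (T.linkSum wt y q).2 := by
  set n := T.linkSum wt y q with hn
  have m0 : ((transport ρ hu y.1 q, Multiplicative.ofAdd n) : SL2 × Multiplicative (ℤ × ℤ)) ∈
      hwt.graph ρ hu y := ⟨q, hq.1, hq.2, rfl, rfl⟩
  have m1 : ((transport ρ hu y.1 p, Multiplicative.ofAdd (1, 0)) :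
      SL2 × Multiplicative (ℤ × ℤ)) ∈ hwt.graph ρ hu y := ⟨p, hp.1, hp.2.1, rfl, hp.2.2⟩
  have m2 : ((transport ρ hu y.1 p', Multiplicative.ofAdd (0, 1)) :
      SL2 × Multiplicative (ℤ × ℤ)) ∈ hwt.graph ρ hu y := ⟨p', hp'.1, hp'.2.1, rfl, hp'.2.2⟩
  obtain ⟨r, hr, hre, hrt, hrs⟩ := mul_mem (inv_mem (mul_mem (zpow_mem m1 n.1) (zpow_mem m2 n.2))) m0
  have hr0 : T.linkSum wt y r = 0 := by
    rw [hrs]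
    change -(n.1 • ((1, 0) : ℤ × ℤ) + n.2 • ((0, 1) : ℤ × ℤ)) + n = 0
    ext <;> simp
  have hone := transport_congr ρ hu (hwt.injective y r hr hre hr0).homotopic
  rw [hrt, transport_nil] at hone
  exact (inv_mul_eq_one.mp hone).symm

/-- Every irreducible boundary-Borel representation is detected by `ℰP(𝒯)`. The parameters `m_s`
and `l_s` are the eigenvalues of the meridian and the longitude. -/
theorem exists_mem_enhancedPtolemy (hconn : T.Connected) (hE : T.transitivePartitions.ncard = 2)
    (hwt : T.IsFraming wt) {k : S} {ρ : T.Pi1 k →* SL2} (hρ : T.BoundaryIn borel ρ)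
    (hirr : IsIrreducible ρ) :
    ∃ z ∈ T.enhancedPtolemy wt,
      T.IsHolonomy (naturalCocycle (T.monomial wt z.2.1 z.2.2) z.1) ρ := by
  obtain ⟨u, hu, hu₀⟩ := exists_paths hconn k
  choose g hg using hρ
  have hy : ∀ s : T.Cusp, T.cuspOf (Quot.out s) = s := Quot.out_eq
  set x : T.Cusp → Fin 2 → ℂ := fun s r => (g (u (Quot.out s).1) (Quot.out s).2).1 r 0 with hx
  have eig : ∀ s q, T.IsLinkPath (Quot.out s) q → T.linkEnd (Quot.out s) q = Quot.out s →
      ∃ z : ℂˣ, (transport ρ hu (Quot.out s).1 q).1 *ᵥ x s = (z : ℂ) • x s := by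
    intro s q hq hqe
    obtain ⟨w, hw, -⟩ := mulVec_of_mem_borel (hg _ _ _ (isPeripheral_closeUp hu hq hqe))
    exact ⟨w, hw⟩
  choose p hp using fun s : T.Cusp => hwt.meridian (Quot.out s)
  choose p' hp' using fun s : T.Cusp => hwt.longitude (Quot.out s)
  choose m hm using fun s => eig s (p s) (hp s).1 (hp s).2.1
  choose l hl using fun s => eig s (p' s) (hp' s).1 (hp' s).2.1
  have hm0 : ∀ s, (m s : ℂ) ≠ 0 := fun s => (m s).ne_zero
  have hl0 : ∀ s, (l s : ℂ) ≠ 0 := fun s => (l s).ne_zero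
  obtain ⟨c, hc, h⟩ := exists_mem_ptolemyWith hE hirr hu hu₀
    (hwt.isCrossingFactor_monomial (m := fun s => (m s : ℂ)) (l := fun s => (l s : ℂ)) hm0
      hl0).ne_zero hy (x := x)
    (fun s => firstColumn_ne_zero _) (fun s q hq hqe => by
      rw [linkProd_monomial hm0 hl0 hq, hy,
        hwt.eq_zpow_mul_zpow ρ hu ⟨hq, hqe⟩ (hp s) (hp' s), mul_comm, mul_smul,
        ← zpow_mulVec (hm0 s) (hm s), ← Matrix.mulVec_smul, ← zpow_mulVec (hl0 s) (hl s),
        Matrix.mulVec_mulVec]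
      rfl)
  exact ⟨(c, _, _), ⟨hm0, hl0, hc⟩, h⟩

end Framing

end Tri

end Ptolemy


theorem theorem1p8 {S : Type u} [Finite S] (T : Ptolemy.Tri S)
    (hconn : T.Connected) (hman : T.IsManifold) (hE : T.transitivePartitions.ncard = 2) :
    -- the Ptolemy variety
    (T.invariantPtolemy = T.virtualImage (fun _ _ _ => 1) T.ptolemy ∧
      Set.BijOn Ptolemy.edgeCoords T.invariantPtolemy T.ptolemy ∧
      ∀ (k : S) (ρ : T.Pi1 k →* Ptolemy.SL2), T.BoundaryIn Ptolemy.unipotent ρ →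
        Ptolemy.IsIrreducible ρ →
        ∃ c ∈ T.ptolemy, T.IsHolonomy (Ptolemy.naturalCocycle (fun _ _ _ => 1) c) ρ) ∧
    -- the Ptolemy varieties for representations in PSL(2, ℂ)
    (∀ (σ : S → Fin 4 → ℤˣ) (η : S → Fin 4 → Fin 4 → ℤˣ),
      T.IsCocycle σ → Ptolemy.Tri.IsPrimitive σ η →
      T.invariantSigma η =
        T.virtualImage (fun k i f => (T.sigmaSign η k i f : ℤ)) (T.sigmaPtolemy η) ∧
      Set.BijOn Ptolemy.edgeCoords (T.invariantSigma η) (T.sigmaPtolemy η) ∧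
      ∀ (k : S) (ρ : T.Pi1 k →* Ptolemy.PSL2), T.BoundaryIn Ptolemy.pslUnipotent ρ →
        T.HasObstructionClass σ ρ → Ptolemy.IsIrreducible ρ →
        ∃ c ∈ T.sigmaPtolemy η,
          T.IsPSLHolonomy (Ptolemy.naturalCocycle (fun _ _ _ => 1) c) ρ) ∧
    -- the enhanced Ptolemy variety
    (∀ wt : S → Fin 4 → Fin 4 → ℤ × ℤ, T.IsFraming wt →
      T.invariantEnhanced wt =
        {z | ∃ c, (c, z.2) ∈ T.enhancedPtolemy wt ∧
          z.1 ∈ T.virtualImage (T.monomial wt z.2.1 z.2.2) {c}} ∧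
      Set.BijOn (fun z => (Ptolemy.edgeCoords z.1, z.2)) (T.invariantEnhanced wt)
        (T.enhancedPtolemy wt) ∧
      ∀ (k : S) (ρ : T.Pi1 k →* Ptolemy.SL2), T.BoundaryIn Ptolemy.borel ρ →
        Ptolemy.IsIrreducible ρ →
        ∃ z ∈ T.enhancedPtolemy wt,
          T.IsHolonomy (Ptolemy.naturalCocycle (T.monomial wt z.2.1 z.2.2) z.1) ρ) := by
  refine ⟨⟨?_, ?_, ?_⟩, ?_, ?_⟩
  · rw [Ptolemy.Tri.invariantPtolemy, Ptolemy.Tri.ptolemy, T.invariantWith_eq hE]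
    simp only [mul_one]
  · have h := T.bijOn_edgeCoords (t := fun _ _ _ => 1)
      ⟨fun _ _ _ => one_ne_zero, fun _ _ _ _ => one_mul 1, fun _ => by simp⟩
    rw [Ptolemy.Tri.invariantPtolemy, Ptolemy.Tri.ptolemy, T.invariantWith_eq hE]
    simpa only [mul_one] using h
  · exact fun k ρ hρ hirr => Ptolemy.Tri.exists_mem_ptolemy hconn hE hρ hirr
  · intro σ η hσ hη
    rw [Ptolemy.Tri.invariantSigma, Ptolemy.Tri.sigmaPtolemy_eq hσ hη, T.invariantWith_eq hE]
    refine ⟨rfl, Ptolemy.Tri.bijOn_edgeCoords (T.isCrossingFactor_sigmaSign η), ?_⟩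
    intro k ρ _ hob hirr
    rw [← Ptolemy.Tri.sigmaPtolemy_eq hσ hη]
    exact Ptolemy.Tri.exists_mem_sigmaPtolemy hE hσ hη hob hirr
  · intro wt hwt
    have bij : ∀ z : (T.Cusp → ℂ) × (T.Cusp → ℂ), (∀ s, z.1 s ≠ 0) → (∀ s, z.2 s ≠ 0) →
        Set.BijOn Ptolemy.edgeCoords (T.invariantWith (T.monomial wt z.1 z.2))
          (T.ptolemyWith fun k f i j =>
            T.monomial wt z.1 z.2 k i f * T.monomial wt z.1 z.2 k j f) := by
      intro z hm hl
      rw [T.invariantWith_eq hE]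
      exact Ptolemy.Tri.bijOn_edgeCoords (hwt.isCrossingFactor_monomial hm hl)
    refine ⟨?_, ⟨?_, ?_, ?_⟩, ?_⟩
    · ext z
      constructor
      · rintro ⟨hm, hl, hz⟩
        rw [T.invariantWith_eq hE] at hz
        obtain ⟨hX, c, hc, hXc⟩ := hz
        exact ⟨c, ⟨hm, hl, hc⟩, hX, c, rfl, hXc⟩
      · rintro ⟨c, ⟨hm, hl, hc⟩, hX, _, rfl, hXc⟩
        refine ⟨hm, hl, ?_⟩
        rw [T.invariantWith_eq hE]
        exact ⟨hX, _, hc, hXc⟩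
    · rintro ⟨X, z⟩ ⟨hm, hl, hX⟩
      exact ⟨hm, hl, (bij z hm hl).mapsTo hX⟩
    · rintro ⟨X, z⟩ ⟨hm, hl, hX⟩ ⟨Y, z'⟩ ⟨_, _, hY⟩ h
      obtain ⟨h1, rfl⟩ := Prod.mk.inj h
      exact Prod.ext ((bij z hm hl).injOn hX hY h1) rfl
    · rintro ⟨c, z⟩ ⟨hm, hl, hc⟩
      obtain ⟨X, hX, rfl⟩ := (bij z hm hl).surjOn hc
      exact ⟨(X, z), ⟨hm, hl, hX⟩, rfl⟩
    · exact fun k ρ hρ hirr => Ptolemy.Tri.exists_mem_enhancedPtolemy hconn hE hwt hρ hirr
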